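/- Write $\mathbb{R}^s=\mathbb{R}^n\times\mathbb{R}^{s-n}$ with $n\ge 1$, $s-n\ge 1$, and let $\pi_\parallel,\pi_\perp$ be the projections onto $\mathbb{R}^n$ and $\mathbb{R}^{s-n}$. A cut-and-project scheme is given by a lattice $\mathcal{L}\subset\mathbb{R}^s$, i.e. the $\mathbb{Z}$-span of an $\mathbb{R}$-basis of $\mathbb{R}^s$. It is called generic if $\pi_\parallel|_{\mathcal{L}}$ and $\pi_\perp|_{\mathcal{L}}$ are injective and $\pi_\perp(\mathcal{L})$ is dense in $\mathbb{R}^{s-n}$. A cut-and-project set in $\mathbb{R}^n$ is a set of the form $$\Sigma(\Omega)=\{\pi_\parallel(l): l\in\mathcal{L},\ \pi_\perp(l)\in\Omega\},$$ where $\mathcal{L}\subset\mathbb{R}^s$ (for some $s>n$) gives a generic cut-and-project scheme and $\Omega\subset\mathbb{R}^{s-n}$ is a bounded set with $\overline{\Omega^\circ}=\overline{\Omega}\neq\emptyset$. For $\lambda\in\mathbb{C}$ let $m_A(\lambda)$ denote the algebraic multiplicity of $\lambda$ as an eigenvalue of $A$, with $m_A(\lambda)=0$ if $\lambda$ is not an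 eigenvalue. Two algebraic numbers are called conjugate, written $\nu\sim\mu$, if they have the same minimal polynomial over $\mathbb{Q}$; in particular $\mu\sim\mu$. **Theorem.** Let $n\ge 1$ and let $A\in\mathbb{R}^{n\times n}$ be a non-singular matrix diagonalizable over $\mathbb{C}$. Then there exists a cut-and-project set $\Sigma(\Omega)\subset\mathbb{R}^n$ with $A\Sigma(\Omega)\subset\Sigma(\Omega)$ if and only if both of the following hold: 1. every (complex) eigenvalue of $A$ is an algebraic integer; 2. every $\mu\in\mathbb{C}$ with $|\mu|>1$ that is conjugate to an eigenvalue of $A$ is itself an eigenvalue of $A$; moreover $m_A(\mu)\ge m_A(\nu)$ for all $\nu\sim\mu$, and the inequality is strict for at least one $\nu\sim\mu$. -/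

import Mathlib

/-- A cut-and-project scheme in `ℝˢ = ℝⁿ × ℝᵐ`, `s = n + m`, `n ≥ 1`, `m ≥ 1`: a full-rank lattice,
i.e. the `ℤ`-span of an `ℝ`-basis of `ℝˢ`. The physical space is `ℝⁿ`, the internal space is
`ℝᵐ`, and the two projections are the coordinate projections. -/
structure CutAndProjectScheme (n m : ℕ) where
  one_le_physical : 1 ≤ n
  one_le_internal : 1 ≤ m
  lattice : Submodule ℤ ((Fin n → ℝ) × (Fin m → ℝ))
  exists_basis : ∃ l : Module.Basis (Fin (n + m)) ℝ ((Fin n → ℝ) × (Fin m → ℝ)),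
    lattice = Submodule.span ℤ (Set.range l)

namespace CutAndProjectScheme

variable {n m : ℕ}

/-- The projection onto the physical space is injective on the lattice. -/
def NonDegenerate (Λ : CutAndProjectScheme n m) : Prop :=
  Set.InjOn Prod.fst (Λ.lattice : Set ((Fin n → ℝ) × (Fin m → ℝ)))

/-- The projection onto the internal space is injective on the lattice. -/
def Aperiodic (Λ : CutAndProjectScheme n m) : Prop :=
  Set.InjOn Prod.snd (Λ.lattice : Set ((Fin n → ℝ) × (Fin m → ℝ)))

/-- The projection of the lattice to the internal space is dense. -/
def IrreducibleScheme (Λ : CutAndProjectScheme n m) : Prop :=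
  Dense (Prod.snd '' (Λ.lattice : Set ((Fin n → ℝ) × (Fin m → ℝ))))

/-- A scheme is generic if it is non-degenerate, aperiodic and irreducible. -/
def Generic (Λ : CutAndProjectScheme n m) : Prop :=
  Λ.NonDegenerate ∧ Λ.Aperiodic ∧ Λ.IrreducibleScheme

/-- The set `Σ(Ω)` of the physical projections of those lattice points whose internal projections
lie in `Ω`. -/
def projectedSet (Λ : CutAndProjectScheme n m) (Ω : Set (Fin m → ℝ)) : Set (Fin n → ℝ) :=
  {x | ∃ l ∈ Λ.lattice, l.1 = x ∧ l.2 ∈ Ω}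

end CutAndProjectScheme

/-- An acceptance window: a bounded set whose closure is non-empty and equals the closure of
its interior. -/
def IsAcceptanceWindow {m : ℕ} (Ω : Set (Fin m → ℝ)) : Prop :=
  Bornology.IsBounded Ω ∧ closure (interior Ω) = closure Ω ∧ (closure Ω).Nonempty

/-- A cut-and-project set in `ℝⁿ`: a set `Σ(Ω)` for an acceptance window `Ω` in the internal space
of a generic cut-and-project scheme. -/
def IsCutAndProjectSet {n : ℕ} (S : Set (Fin n → ℝ)) : Prop :=
  ∃ (m : ℕ) (Λ : CutAndProjectScheme n m) (Ω : Set (Fin m → ℝ)),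
    Λ.Generic ∧ IsAcceptanceWindow Ω ∧ S = Λ.projectedSet Ω

namespace Matrix

variable {n : ℕ}

/-- A real matrix regarded as a complex matrix. -/
noncomputable def complexified (A : Matrix (Fin n) (Fin n) ℝ) : Matrix (Fin n) (Fin n) ℂ :=
  A.map (algebraMap ℝ ℂ)

/-- `A` is similar over `ℂ` to a diagonal matrix. -/
def DiagonalizableOverComplex (A : Matrix (Fin n) (Fin n) ℝ) : Prop :=
  ∃ (P : Matrix (Fin n) (Fin n) ℂ) (d : Fin n → ℂ),
    IsUnit P.det ∧ A.complexified * P = P * Matrix.diagonal d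

/-- The algebraic multiplicity of `z` as an eigenvalue of `A`; it is `0` if `z` is not an
eigenvalue. -/
noncomputable def eigenMultiplicity (A : Matrix (Fin n) (Fin n) ℝ) (z : ℂ) : ℕ :=
  A.complexified.charpoly.rootMultiplicity z

end Matrix

/-! Necessity. Since `π⊥` of the lattice is dense, the lattice is generated by vectors with small
internal part. Each such vector is a difference of two lattice points over the window, so `A` lifts
to an endomorphism of the lattice. Recurrence modulo the lattice shows that the lift preserves the
physical space. It therefore equals `A ⊕ B`, where the orbits of `B` are bounded because the window
is bounded and lattice points over it stay over it. Hence `χ_A χ_B` is monic and integral, so `m_A +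
m_B` is constant on conjugacy classes, while `m_B(μ) = 0` for `|μ| > 1`. This gives integrality and
`m_A(ν) ≤ m_A(μ)`. If equality held for every conjugate, the minimal polynomial `f` of `μ` would be
coprime to `χ_B`. An integral kernel vector of `f` at the lifted map would then have zero internal
part, contradicting aperiodicity.

Sufficiency. For each minimal polynomial of an eigenvalue, take as many companion-type blocks as its
roots of modulus greater than 1 have multiplicity in `A`, or `n + 1` blocks if there are none. The
resulting integral matrix `C` contains the spectrum of `A`, and its remaining eigenvalues lie in the
closed unit disc. Real intertwiners with `AP = PC`, `CJ = JA`, `PJ = 1` split `ℝ^σ` into the image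
of `J`, a copy of `ℝⁿ`, and `ker P`. The lattice is `ℤ^σ`, and the window consists of the vectors of
`ker P` whose whole `C`-orbit stays in the unit ball.

The scheme is generic once countably many polynomials in the entries of `(P, J)` are non-zero. On a
real linear space of intertwiners it is enough to find, for each condition separately, one complex
solution, and rank-one matrices built from eigenvectors supply these. Density reduces to such a
condition because a spanning subgroup that is not dense carries a non-zero integer-valued
functional. -/

/-! ### Common non-vanishing of countably many polynomials. -/

section Genericity

open MvPolynomial

/-- Countably many nonzero real polynomials have a common point of non-vanishing. -/
theorem MvPolynomial.exists_forall_eval_ne_zero_fin {ι : Type*} [Countable ι] :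
    ∀ (N : ℕ) (p : ι → MvPolynomial (Fin N) ℝ), (∀ i, p i ≠ 0) →
      ∃ x : Fin N → ℝ, ∀ i, eval x (p i) ≠ 0 := by
  intro N
  induction N with
  | zero =>
    intro p hp
    refine ⟨Fin.elim0, fun i h => hp i ?_⟩
    rw [eq_C_of_isEmpty (p i)] at h ⊢
    rw [eval_C] at h
    rw [h, C_0]
  | succ N ih =>
    intro p hp
    -- Induction on the leading coefficients in the first variable: at a common non-vanishing point
    -- of these, every polynomial becomes a non-zero univariate one, and the countably many roots do
    -- not exhaust `ℝ`.
    have hq : ∀ i, (finSuccEquiv ℝ N (p i)).leadingCoeff ≠ 0 := fun i => by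
      rw [Ne, Polynomial.leadingCoeff_eq_zero]
      exact fun h => hp i ((finSuccEquiv ℝ N).injective (by rw [h, map_zero]))
    obtain ⟨x, hx⟩ := ih _ hq
    let q : ι → Polynomial ℝ := fun i => (finSuccEquiv ℝ N (p i)).map (eval x)
    have hq0 : ∀ i, q i ≠ 0 := fun i h => hx i <| by
      have := congrArg (fun r => Polynomial.coeff r (finSuccEquiv ℝ N (p i)).natDegree) h
      simpa [q, Polynomial.coeff_map] using this
    have hc : (⋃ i, {y : ℝ | (q i).IsRoot y}).Countable :=
      Set.countable_iUnion fun i => (Polynomial.finite_setOfPred_isRoot (hq0 i)).countable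
    obtain ⟨y, hy⟩ : ∃ y, y ∉ ⋃ i, {y : ℝ | (q i).IsRoot y} := by
      by_contra! h
      exact Cardinal.not_countable_real ((Set.eq_univ_of_forall h) ▸ hc)
    refine ⟨Fin.cons y x, fun i h => hy ?_⟩
    rw [eval_eq_eval_mv_eval'] at h
    exact Set.mem_iUnion.2 ⟨i, h⟩

/-- A countable family of polynomial systems, each of which is satisfied by some complex point
whose real and imaginary parts lie in `T`, has a common real solution in `T`, where a system is
satisfied when one of its members does not vanish. -/
theorem Submodule.exists_forall_exists_eval_ne_zero {ι κ : Type*} [Countable ι] [Finite κ]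
    {τ : ι → Type*} (T : Submodule ℝ (κ → ℝ)) (p : ∀ i, τ i → MvPolynomial κ ℝ)
    (h : ∀ i, ∃ w : κ → ℂ, (fun k => (w k).re) ∈ T ∧ (fun k => (w k).im) ∈ T ∧
      ∃ t, aeval w (p i t) ≠ 0) :
    ∃ x ∈ T, ∀ i, ∃ t, eval x (p i t) ≠ 0 := by
  classical
  choose w hre him t ht using h
  let b := Module.finBasis ℝ T
  -- Coordinates on `T`: substituting `g` restricts a polynomial to `T`. The restriction is non-zero
  -- because it does not vanish at the complex coordinates of `w i`.
  let g : κ → MvPolynomial (Fin (Module.finrank ℝ T)) ℝ := fun k => ∑ j, C ((b j : κ → ℝ) k) * X j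
  have hne : ∀ i, bind₁ g (p i (t i)) ≠ 0 := by
    intro i h0
    apply ht i
    have hw : w i = fun k => aeval (fun j => ((b.repr ⟨_, hre i⟩ j : ℝ) : ℂ) +
        ((b.repr ⟨_, him i⟩ j : ℝ) : ℂ) * Complex.I) (g k) := by
      funext k
      have h1 := congrFun (congrArg Subtype.val (b.sum_repr ⟨_, hre i⟩)) k
      have h2 := congrFun (congrArg Subtype.val (b.sum_repr ⟨_, him i⟩)) k
      simp only [Submodule.coe_sum, Submodule.coe_smul, Finset.sum_apply, Pi.smul_apply,
        smul_eq_mul] at h1 h2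
      simp only [g, map_sum, map_mul, algHom_C, aeval_X, Complex.coe_algebraMap]
      conv_lhs => rw [← Complex.re_add_im (w i k), ← h1, ← h2]
      push_cast
      rw [Finset.sum_mul, ← Finset.sum_add_distrib]
      exact Finset.sum_congr rfl fun j _ => by ring
    rw [hw, ← aeval_bind₁, h0, map_zero]
  obtain ⟨y, hy⟩ := exists_forall_eval_ne_zero_fin _ _ hne
  refine ⟨(∑ j, y j • b j : T), Subtype.coe_prop _, fun i => ⟨t i, ?_⟩⟩
  have := hy i
  rw [← coe_aeval_eq_eval, RingHom.coe_coe, aeval_bind₁] at this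
  convert this using 3
  rw [← coe_aeval_eq_eval, RingHom.coe_coe]
  congr 2
  funext k
  simp [g, Finset.sum_apply, mul_comm]

end Genericity

/-! ### Integral functionals on non-dense subgroups. -/

section Density

/-- A subgroup of a finite-dimensional real space which is not dense, but spans, has a nonzero
linear functional taking integer values on it. -/
theorem AddSubgroup.exists_integral_functional {V : Type*} [NormedAddCommGroup V]
    [NormedSpace ℝ V] [FiniteDimensional ℝ V] (G : AddSubgroup V)
    (hspan : Submodule.span ℝ (G : Set V) = ⊤) (hG : ¬ Dense (G : Set V)) :
    ∃ φ : V →ₗ[ℝ] ℝ, φ ≠ 0 ∧ ∀ g ∈ G, ∃ k : ℤ, φ g = k := by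
  classical
  set H := G.topologicalClosure
  have hGH : G ≤ H := G.le_topologicalClosure
  have hHc : IsClosed (H : Set V) := G.isClosed_topologicalClosure
  -- The largest linear subspace contained in the closure `H`; modulo `W`, the group `H` is a
  -- lattice.
  let W : Submodule ℝ V :=
    { carrier := {v | ∀ t : ℝ, t • v ∈ H}
      add_mem' := fun {a b} ha hb t => by rw [smul_add]; exact H.add_mem (ha t) (hb t)
      zero_mem' := fun t => by rw [smul_zero]; exact H.zero_mem
      smul_mem' := fun c v hv t => by rw [smul_smul]; exact hv _ }
  have hWH : ∀ v ∈ W, v ∈ H := fun v hv => by simpa using hv 1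
  obtain ⟨W', hW'⟩ := W.exists_isCompl
  let L : Submodule ℤ W' := AddSubgroup.toIntSubmodule (H.comap W'.subtype.toAddMonoidHom)
  have memL : ∀ v : W', v ∈ L ↔ (v : V) ∈ H := fun v => Iff.rfl
  have hLc : IsClosed (L : Set W') := hHc.preimage continuous_subtype_val
  -- `L` is discrete, since `W'` contains no line of `H`
  have hdisc : DiscreteTopology L := by
    by_contra hnd
    have hacc : ∀ ε > 0, ∃ v ∈ L, v ≠ 0 ∧ ‖v‖ < ε := by
      by_contra! hcon
      obtain ⟨ε, hε, hcon⟩ := hcon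
      apply hnd
      refine discreteTopology_of_isOpen_singleton_zero ?_
      rw [Metric.isOpen_singleton_iff]
      refine ⟨ε, hε, fun y hy => ?_⟩
      by_contra hy0
      have := hcon y y.2 (fun h => hy0 (Subtype.ext h))
      rw [dist_zero_right] at hy
      exact absurd hy (not_lt.2 this)
    choose v hvL hv0 hvn using fun k : ℕ => hacc (1 / ((k : ℝ) + 1)) (by positivity)
    have hpos : ∀ k, 0 < ‖v k‖ := fun k => norm_pos_iff.2 (hv0 k)
    have hlim : Filter.Tendsto (fun k => ‖v k‖) Filter.atTop (nhds 0) :=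
      squeeze_zero (fun k => (hpos k).le) (fun k => (hvn k).le)
        tendsto_one_div_add_atTop_nhds_zero_nat
    obtain ⟨u, hu, ψ, hψ, hψu⟩ := (isCompact_sphere (0 : W') 1).tendsto_subseq
      (x := fun k => ‖v k‖⁻¹ • v k) (fun k => by
        rw [mem_sphere_zero_iff_norm, norm_smul, norm_inv, norm_norm, inv_mul_cancel₀ (hpos k).ne'])
    have hu0 : u ≠ 0 := fun h => by simp [h] at hu
    apply hu0
    -- The vector `⌊t / ‖v‖⌋ • v` lies in `L` and differs from `t • (v / ‖v‖)` by less than `‖v‖`,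
    -- which tends to 0. So the whole line through the limit direction `u` lies in `H`.
    have huW : (u : V) ∈ W := by
      intro t
      have hmem : ∀ k, ⌊t * ‖v (ψ k)‖⁻¹⌋ • v (ψ k) ∈ L := fun k => L.smul_mem _ (hvL _)
      have htend : Filter.Tendsto (fun k => ⌊t * ‖v (ψ k)‖⁻¹⌋ • v (ψ k)) Filter.atTop
          (nhds (t • u)) := by
        have h1 : Filter.Tendsto (fun k => t • (‖v (ψ k)‖⁻¹ • v (ψ k))) Filter.atTop
          (nhds (t • u)) := hψu.const_smul t
        have h2 : Filter.Tendsto (fun k => Int.fract (t * ‖v (ψ k)‖⁻¹) • v (ψ k)) Filter.atTop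
            (nhds 0) := by
          rw [tendsto_zero_iff_norm_tendsto_zero]
          refine squeeze_zero (fun k => norm_nonneg _) (fun k => ?_)
            (hlim.comp hψ.tendsto_atTop)
          rw [norm_smul, Real.norm_of_nonneg (Int.fract_nonneg _)]
          exact mul_le_of_le_one_left (norm_nonneg _) (Int.fract_lt_one _).le
        have h3 := h1.sub h2
        rw [sub_zero] at h3
        refine h3.congr fun k => ?_
        rw [smul_smul, ← sub_smul, ← Int.cast_smul_eq_zsmul ℝ]
        congr 1
        rw [Int.fract]; ring
      exact (memL _).1 (hLc.mem_of_tendsto htend (Filter.Eventually.of_forall hmem))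
    exact Subtype.ext ((Submodule.disjoint_def.1 hW'.disjoint) _ huW u.2)
  let π := W'.projectionOnto W hW'.symm
  have hπL : ∀ g ∈ H, π g ∈ L := by
    intro g hg
    rw [memL]
    have h1 : g - (π g : V) ∈ W := by
      have : π (g - (π g : V)) = 0 := by
        rw [map_sub, Submodule.projectionOnto_apply_left, sub_self]
      rwa [← LinearMap.mem_ker, Submodule.ker_projectionOnto] at this
    have := H.sub_mem hg (hWH _ h1)
    simpa using this
  have hπs : Function.Surjective π := fun w => ⟨w, Submodule.projectionOnto_apply_left hW'.symm w⟩
  have : IsZLattice ℝ L := ⟨by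
    rw [eq_top_iff, ← LinearMap.range_eq_top.2 hπs, LinearMap.range_eq_map, ← hspan,
      Submodule.map_span]
    refine Submodule.span_mono ?_
    rintro _ ⟨g, hg, rfl⟩
    exact hπL g (hGH hg)⟩
  have hne : Nontrivial W' := by
    rw [Submodule.nontrivial_iff_ne_bot]
    rintro rfl
    have hW : W = ⊤ := by simpa using hW'.sup_eq_top
    apply hG
    rw [dense_iff_closure_eq, ← AddSubgroup.topologicalClosure_coe, Set.eq_univ_iff_forall]
    exact fun v => hWH v (hW ▸ Submodule.mem_top)
  let b := (Module.Free.chooseBasis ℤ L).ofZLatticeBasis ℝ L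
  obtain ⟨i⟩ : Nonempty (Module.Free.ChooseBasisIndex ℤ L) := b.index_nonempty
  -- A coordinate in a `ℤ`-basis of `L`, composed with the projection along `W`, is integral on all
  -- of `H`.
  refine ⟨(b.coord i).comp π, fun h0 => ?_, fun g hg =>
    ⟨(Module.Free.chooseBasis ℤ L).repr ⟨π g, hπL g (hGH hg)⟩ i, ?_⟩⟩
  · obtain ⟨x, hx⟩ := hπs (b i)
    have := LinearMap.congr_fun h0 x
    simp [hx] at this
  · exact Module.Basis.ofZLatticeBasis_repr_apply ℝ L _ ⟨π g, hπL g (hGH hg)⟩ i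

end Density

/-! ### Small generators and recurrence for lattices. -/

section LatticeExtension

/-- A lattice whose internal projection is dense is generated by its elements of small internal
projection. -/
theorem Submodule.le_of_forall_norm_snd_lt {E F : Type*} [AddCommGroup E] [NormedAddCommGroup F]
    [NormedSpace ℝ F] {L H : Submodule ℤ (E × F)} (hL : Dense (Prod.snd '' (L : Set (E × F))))
    {ε : ℝ} (hε : 0 < ε) (h : ∀ v ∈ L, ‖v.2‖ < ε → v ∈ H) : L ≤ H := by
  intro v hv
  obtain ⟨k, hk⟩ := exists_nat_gt (‖v.2‖ / (ε / 2))
  have hk0 : (0 : ℝ) < k := lt_of_le_of_lt (by positivity) hk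
  -- With this radius both `u` and `v - k • u` have internal part shorter than `ε`, and `v` is built
  -- from these two.
  obtain ⟨_, hu', u, hu, rfl⟩ := Metric.dense_iff.1 hL ((k : ℝ)⁻¹ • v.2) (ε / 2 / k) (by positivity)
  rw [Metric.mem_ball, dist_eq_norm] at hu'
  have hk1 : (1 : ℝ) ≤ k := by exact_mod_cast Nat.pos_of_ne_zero (by rintro rfl; simp at hk0)
  have h1 : ‖(k : ℝ)⁻¹ • v.2‖ < ε / 2 := by
    rw [norm_smul, norm_inv, Real.norm_of_nonneg hk0.le, inv_mul_lt_iff₀ hk0, ← div_lt_iff₀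
      (by positivity)]
    exact hk
  have hu1 : u ∈ H := by
    refine h u hu ?_
    have h2 : ε / 2 / k ≤ ε / 2 := div_le_self (by positivity) hk1
    calc ‖u.2‖ = ‖(u.2 - (k : ℝ)⁻¹ • v.2) + (k : ℝ)⁻¹ • v.2‖ := by rw [sub_add_cancel]
      _ ≤ _ := norm_add_le _ _
      _ < ε := by linarith
  have hu2 : v - k • u ∈ H := by
    refine h _ (L.sub_mem hv (L.smul_of_tower_mem k hu)) ?_
    have h3 : (v - k • u).2 = (k : ℝ) • ((k : ℝ)⁻¹ • v.2 - u.2) := by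
      rw [smul_sub, smul_inv_smul₀ hk0.ne', Prod.snd_sub, Prod.smul_snd, Nat.cast_smul_eq_nsmul]
    rw [h3, norm_smul, Real.norm_of_nonneg hk0.le, norm_sub_rev]
    have := mul_lt_mul_of_pos_left hu' hk0
    rw [mul_div_cancel₀ _ hk0.ne'] at this
    linarith
  have := H.add_mem hu2 (H.smul_of_tower_mem k hu1)
  rwa [sub_add_cancel] at this

/-- Some positive multiple of a vector is as close as desired to a given lattice. -/
theorem Module.Basis.exists_nat_smul_near {ι E : Type*} [Fintype ι] [NormedAddCommGroup E]
    [NormedSpace ℝ E] [FiniteDimensional ℝ E] (l : Module.Basis ι ℝ E) (v : E) {ε : ℝ}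
    (hε : 0 < ε) :
    ∃ k : ℕ, 1 ≤ k ∧ ∃ u ∈ Submodule.span ℤ (Set.range l), ‖(k : ℝ) • v - u‖ < ε := by
  have hb : ∀ k : ℕ, ZSpan.fract l ((k : ℝ) • v) ∈ ZSpan.fundamentalDomain l := fun k =>
    ZSpan.fract_mem_fundamentalDomain l _
  -- Pigeonhole by compactness: two multiples of `v` with nearby fractional parts differ by almost a
  -- lattice vector.
  obtain ⟨a, -, φ, hφ, ha⟩ := tendsto_subseq_of_bounded (ZSpan.fundamentalDomain_isBounded l) hb
  obtain ⟨N, hN⟩ := Metric.cauchySeq_iff'.1 ha.cauchySeq ε hε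
  have h := hN (N + 1) N.le_succ
  have hlt : φ N < φ (N + 1) := hφ N.lt_succ_self
  refine ⟨φ (N + 1) - φ N, Nat.sub_pos_of_lt hlt, (ZSpan.floor l ((φ (N + 1) : ℝ) • v) : E) -
    (ZSpan.floor l ((φ N : ℝ) • v) : E), Submodule.sub_mem _ (Subtype.coe_prop _)
      (Subtype.coe_prop _), ?_⟩
  rw [dist_eq_norm] at h
  have heq : ((φ (N + 1) - φ N : ℕ) : ℝ) • v - ((ZSpan.floor l ((φ (N + 1) : ℝ) • v) : E) -
      (ZSpan.floor l ((φ N : ℝ) • v) : E)) =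
      ZSpan.fract l ((φ (N + 1) : ℝ) • v) - ZSpan.fract l ((φ N : ℝ) • v) := by
    rw [ZSpan.fract_apply, ZSpan.fract_apply, Nat.cast_sub hlt.le, sub_smul]
    abel
  rw [heq]
  exact h

end LatticeExtension

/-! ### Lifting `A` to the lattice. -/

section Necessity

open CutAndProjectScheme

variable {n m : ℕ}

/-- A linear map preserving a cut-and-project set extends to an endomorphism of the lattice, which
acts on the internal space by a map with bounded orbits. -/
theorem CutAndProjectScheme.exists_integral_extension (Λ : CutAndProjectScheme n m)
    (hΛ : Λ.Generic) {Ω : Set (Fin m → ℝ)} (hΩ : IsAcceptanceWindow Ω)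
    (A : Matrix (Fin n) (Fin n) ℝ) (hA : A.mulVec '' Λ.projectedSet Ω ⊆ Λ.projectedSet Ω) :
    ∃ (l : Module.Basis (Fin (n + m)) ℝ ((Fin n → ℝ) × (Fin m → ℝ)))
      (M : Matrix (Fin (n + m)) (Fin (n + m)) ℤ) (B : (Fin m → ℝ) →ₗ[ℝ] (Fin m → ℝ)),
      Λ.lattice = Submodule.span ℤ (Set.range l) ∧
      LinearMap.toMatrix l l (A.mulVecLin.prodMap B) = M.map (Int.castRingHom ℝ) ∧
      ∀ x, ∃ K, ∀ k : ℕ, ‖(B ^ k) x‖ ≤ K := by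
  obtain ⟨hnd, hap, hirr⟩ := hΛ
  obtain ⟨hbd, hcl, hne⟩ := hΩ
  obtain ⟨l, hl⟩ := Λ.exists_basis
  obtain ⟨R, hR⟩ := hbd.exists_norm_le
  have hint : (interior Ω).Nonempty := by
    rw [← closure_nonempty_iff, hcl]; exact hne
  obtain ⟨y₀, hy₀⟩ := hint
  obtain ⟨r, hr, hball⟩ := Metric.isOpen_iff.1 isOpen_interior y₀ hy₀
  replace hball : Metric.ball y₀ r ⊆ Ω := hball.trans interior_subset
  -- lattice vectors projecting into the window are mapped to such vectors
  have hstep : ∀ v ∈ Λ.lattice, v.2 ∈ Ω → ∃ w ∈ Λ.lattice, w.1 = A.mulVec v.1 ∧ w.2 ∈ Ω :=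
    fun v hv hv2 => hA ⟨v.1, ⟨v, hv, rfl, hv2⟩, rfl⟩
  obtain ⟨_, hx₀, x₀, hx₀L, rfl⟩ := Metric.dense_iff.1 hirr y₀ (r / 2) (by positivity)
  have hx₀Ω : x₀.2 ∈ Ω := hball (Metric.ball_subset_ball (by linarith) hx₀)
  -- Both `x₀` and `x₀ + v` project into the window. The difference of the two images lifts `A v.1`,
  -- and its internal part has norm at most `2 * R`.
  have hsmall : ∀ v ∈ Λ.lattice, ‖v.2‖ < r / 2 →
      ∃ w ∈ Λ.lattice, w.1 = A.mulVec v.1 ∧ ‖w.2‖ ≤ 2 * R := by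
    intro v hv hvr
    obtain ⟨a, ha, ha1, ha2⟩ := hstep (x₀ + v) (Λ.lattice.add_mem hx₀L hv) (hball (by
      rw [Metric.mem_ball, dist_eq_norm] at hx₀ ⊢
      calc ‖(x₀ + v).2 - y₀‖ = ‖(x₀.2 - y₀) + v.2‖ := by rw [Prod.snd_add]; congr 1; abel
        _ ≤ _ := norm_add_le _ _
        _ < r := by linarith))
    obtain ⟨b, hb, hb1, hb2⟩ := hstep x₀ hx₀L hx₀Ω
    refine ⟨a - b, Λ.lattice.sub_mem ha hb, ?_, ?_⟩
    · rw [Prod.fst_sub, ha1, hb1, Prod.fst_add, Matrix.mulVec_add, add_sub_cancel_left]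
    · rw [Prod.snd_sub]
      have := norm_sub_le a.2 b.2
      linarith [hR _ ha2, hR _ hb2]
  let H : Submodule ℤ ((Fin n → ℝ) × (Fin m → ℝ)) := AddSubgroup.toIntSubmodule
    { carrier := {v | ∃ w ∈ Λ.lattice, w.1 = A.mulVec v.1}
      add_mem' := by
        rintro _ _ ⟨a, ha, ha'⟩ ⟨b, hb, hb'⟩
        exact ⟨a + b, Λ.lattice.add_mem ha hb, by
          rw [Prod.fst_add, ha', hb', Prod.fst_add, Matrix.mulVec_add]⟩
      zero_mem' := ⟨0, Λ.lattice.zero_mem, by simp⟩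
      neg_mem' := by
        rintro _ ⟨a, ha, ha'⟩
        exact ⟨-a, Λ.lattice.neg_mem ha, by rw [Prod.fst_neg, ha', Prod.fst_neg,
          Matrix.mulVec_neg]⟩ }
  have hLH : Λ.lattice ≤ H := Submodule.le_of_forall_norm_snd_lt hirr (half_pos hr)
    fun v hv hvr => let ⟨w, hw, hw', _⟩ := hsmall v hv hvr; ⟨w, hw, hw'⟩
  have hlL : ∀ i, l i ∈ Λ.lattice := fun i => hl ▸ Submodule.subset_span ⟨i, rfl⟩
  choose w hwL hw1 using fun i => hLH (hlL i)
  let C := l.constr ℝ w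
  have hC1 : ∀ v, (C v).1 = A.mulVec v.1 := by
    have : (LinearMap.fst ℝ (Fin n → ℝ) (Fin m → ℝ)).comp C = A.mulVecLin.comp
        (LinearMap.fst ℝ _ _) := l.ext fun i => by
      simpa [C, Module.Basis.constr_basis] using hw1 i
    exact fun v => LinearMap.congr_fun this v
  have hCL : ∀ v ∈ Λ.lattice, C v ∈ Λ.lattice := by
    intro v hv
    rw [hl] at hv
    induction hv using Submodule.span_induction with
    | mem x hx =>
      obtain ⟨i, rfl⟩ := hx
      rw [Module.Basis.constr_basis]; exact hwL i
    | zero => rw [map_zero]; exact Λ.lattice.zero_mem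
    | add x y _ _ hx hy => rw [map_add]; exact Λ.lattice.add_mem hx hy
    | smul a x _ hx => rw [map_zsmul]; exact Λ.lattice.smul_mem a hx
  have hCsmall : ∀ v ∈ Λ.lattice, ‖v.2‖ < r / 2 → ‖(C v).2‖ ≤ 2 * R := by
    intro v hv hvr
    obtain ⟨u, hu, hu1, hu2⟩ := hsmall v hv hvr
    rwa [hnd (hCL v hv) hu (by rw [hC1, hu1])]
  -- the physical space is invariant
  have hCphys : ∀ x, (C (x, 0)).2 = 0 := by
    intro x
    let T : ((Fin n → ℝ) × (Fin m → ℝ)) →L[ℝ] (Fin m → ℝ) :=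
      LinearMap.toContinuousLinearMap ((LinearMap.snd ℝ _ _).comp C)
    have hT : ∀ v, T v = (C v).2 := fun v => rfl
    by_contra hx
    have hpos : 0 < ‖T (x, 0)‖ := norm_pos_iff.2 hx
    -- `N` is so large that every positive multiple of `N • (x, 0)` has an image whose internal part
    -- exceeds the bound. By recurrence, some such multiple is within `r / 2` of a lattice vector
    -- `u` with small internal part, for which `hCsmall` forces the bound.
    obtain ⟨N, hN⟩ := exists_nat_gt ((2 * R + ‖T‖ * (r / 2)) / ‖T (x, 0)‖)
    obtain ⟨k, hk, u, hu, huk⟩ := l.exists_nat_smul_near ((N : ℝ) • ((x, 0) :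
      (Fin n → ℝ) × (Fin m → ℝ))) (half_pos hr)
    rw [← hl] at hu
    have hu2 : ‖u.2‖ < r / 2 := by
      refine lt_of_le_of_lt ?_ huk
      have := norm_snd_le ((k : ℝ) • (N : ℝ) • ((x, 0) : (Fin n → ℝ) × (Fin m → ℝ)) - u)
      simpa using this
    have h1 := hCsmall u hu hu2
    rw [← hT] at h1
    have h2 : ‖T ((k : ℝ) • (N : ℝ) • ((x, 0) : (Fin n → ℝ) × (Fin m → ℝ)))‖ ≤
        2 * R + ‖T‖ * (r / 2) := by
      have h3 := T.le_opNorm ((k : ℝ) • (N : ℝ) • ((x, 0) : (Fin n → ℝ) × (Fin m → ℝ)) - u)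
      have h4 := mul_le_mul_of_nonneg_left huk.le (norm_nonneg T)
      rw [map_sub] at h3
      have h5 := norm_le_norm_add_norm_sub' (T ((k : ℝ) • (N : ℝ) • ((x, 0) :
        (Fin n → ℝ) × (Fin m → ℝ)))) (T u)
      linarith
    rw [map_smul, map_smul, norm_smul, norm_smul, Real.norm_of_nonneg (Nat.cast_nonneg k),
      Real.norm_of_nonneg (Nat.cast_nonneg N)] at h2
    rw [div_lt_iff₀ hpos] at hN
    have hk1 : (1 : ℝ) ≤ k := by exact_mod_cast hk
    nlinarith [mul_nonneg (Nat.cast_nonneg (α := ℝ) N) hpos.le]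
  let B : (Fin m → ℝ) →ₗ[ℝ] (Fin m → ℝ) :=
    (LinearMap.snd ℝ _ _).comp (C.comp (LinearMap.inr ℝ (Fin n → ℝ) (Fin m → ℝ)))
  have hCB : C = A.mulVecLin.prodMap B := by
    refine LinearMap.ext fun v => Prod.ext (hC1 v) ?_
    have : v = (v.1, 0) + (0, v.2) := by simp
    conv_lhs => rw [this, map_add, Prod.snd_add, hCphys, zero_add]
    rfl
  have hC2 : ∀ v, (C v).2 = B v.2 := fun v => by rw [hCB]; rfl
  have hint : ∀ i j, ∃ k : ℤ, LinearMap.toMatrix l l C i j = k := by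
    intro i j
    rw [LinearMap.toMatrix_apply]
    obtain ⟨k, hk⟩ := (l.mem_span_iff_repr_mem ℤ _).1 (hl ▸ hCL _ (hlL j)) i
    exact ⟨k, hk.symm⟩
  choose M hM using hint
  refine ⟨l, Matrix.of M, B, hl, ?_, ?_⟩
  · rw [← hCB]
    ext i j
    simpa using hM i j
  -- the window is invariant up to closure, so orbits are bounded
  have horb : ∀ k : ℕ, ∀ v ∈ Λ.lattice, v.2 ∈ Ω → (B ^ k) v.2 ∈ Ω := by
    intro k
    induction k with
    | zero => intro v _ hv; simpa using hv
    | succ k ih =>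
      intro v hv hv2
      obtain ⟨u, hu, hu1, hu2⟩ := hstep v hv hv2
      have : C v = u := hnd (hCL v hv) hu (by rw [hC1, hu1])
      have := ih u hu hu2
      rw [pow_succ, Module.End.mul_apply, ← hC2]
      rwa [‹C v = u›]
  have horb2 : ∀ k : ℕ, ∀ y ∈ Metric.ball y₀ r, ‖(B ^ k) y‖ ≤ R := by
    intro k y hy
    have hcont : Continuous fun y => ‖(B ^ k) y‖ :=
      (LinearMap.continuous_of_finiteDimensional _).norm
    have hclosed : IsClosed {y | ‖(B ^ k) y‖ ≤ R} := isClosed_le hcont continuous_const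
    have hd := hirr.open_subset_closure_inter (Metric.isOpen_ball (x := y₀) (ε := r))
    refine closure_minimal ?_ hclosed (hd hy)
    rintro _ ⟨hv', v, hv, rfl⟩
    exact hR _ (horb k v hv (hball hv'))
  intro x
  obtain ⟨c, hc, hcx⟩ : ∃ c : ℝ, 0 < c ∧ ‖c • x‖ < r := by
    refine ⟨r / (‖x‖ + 1), by positivity, ?_⟩
    rw [norm_smul, Real.norm_of_nonneg (by positivity), div_mul_eq_mul_div, div_lt_iff₀
      (by positivity)]
    nlinarith [norm_nonneg x]
  refine ⟨c⁻¹ * (2 * R), fun k => ?_⟩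
  -- `c • x` is a difference of two points of the ball, whose orbits are bounded by `R`.
  have h1 := horb2 k (y₀ + c • x) (by simpa using hcx)
  have h2 := horb2 k y₀ (by simpa using hr)
  rw [map_add, map_smul] at h1
  have h3 : ‖c • (B ^ k) x‖ ≤ 2 * R := by
    have := norm_sub_le ((B ^ k) y₀ + c • (B ^ k) x) ((B ^ k) y₀)
    rw [add_sub_cancel_left] at this
    linarith
  rw [norm_smul, Real.norm_of_nonneg hc.le] at h3
  rwa [le_inv_mul_iff₀ hc]

end Necessity

/-! ### Eigenvalues, conjugates and bounded orbits. -/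

section Eigenvalues

open Polynomial

/-- Multiplicity counts vanishing iterated derivatives. These have rational coefficients, so their
vanishing at a point depends only on its minimal polynomial. -/
theorem Polynomial.rootMultiplicity_map_eq_of_isConjRoot {G : ℤ[X]} (hG : G ≠ 0) {μ ν : ℂ}
    (h : IsConjRoot ℚ μ ν) :
    (G.map (algebraMap ℤ ℂ)).rootMultiplicity μ = (G.map (algebraMap ℤ ℂ)).rootMultiplicity ν := by
  have hG' : G.map (algebraMap ℤ ℂ) ≠ 0 := by
    rwa [Ne, Polynomial.map_eq_zero_iff (algebraMap ℤ ℂ).injective_int]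
  have key : ∀ (m : ℕ) (x : ℂ), (derivative^[m] (G.map (algebraMap ℤ ℂ))).IsRoot x ↔
      minpoly ℚ x ∣ (derivative^[m] G).map (algebraMap ℤ ℚ) := fun m x => by
    rw [minpoly.dvd_iff, aeval_map_algebraMap, iterate_derivative_map, IsRoot.def,
      eval_map_algebraMap]
  refine eq_of_forall_lt_iff fun c => ?_
  rw [lt_rootMultiplicity_iff_isRoot_iterate_derivative hG',
    lt_rootMultiplicity_iff_isRoot_iterate_derivative hG']
  simp only [key, isConjRoot_def.1 h]

theorem Matrix.exists_mulVec_eq_smul_of_isRoot_charpoly {ι K : Type*} [Fintype ι] [DecidableEq ι]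
    [Field K] {N : Matrix ι ι K} {μ : K} (h : N.charpoly.IsRoot μ) :
    ∃ v ≠ 0, N.mulVec v = μ • v := by
  rw [IsRoot.def, Matrix.eval_charpoly, ← Matrix.exists_mulVec_eq_zero_iff] at h
  obtain ⟨v, hv, hv'⟩ := h
  refine ⟨v, hv, ?_⟩
  rw [Matrix.sub_mulVec, sub_eq_zero] at hv'
  rw [← hv', Matrix.scalar_apply]
  ext i
  simp [Matrix.mulVec_diagonal]

theorem Matrix.pow_mulVec_eq_smul {ι K : Type*} [Fintype ι] [DecidableEq ι]
    [CommRing K] {N : Matrix ι ι K} {μ : K} {v : ι → K} (h : N.mulVec v = μ • v) (k : ℕ) :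
    (N ^ k).mulVec v = μ ^ k • v := by
  induction k with
  | zero => simp
  | succ k ih => rw [pow_succ, ← Matrix.mulVec_mulVec, h, Matrix.mulVec_smul, ih, smul_smul,
      pow_succ']

theorem Matrix.aeval_mulVec_eq_smul {ι R K : Type*} [Fintype ι] [DecidableEq ι] [CommRing R]
    [CommRing K] [Algebra R K] {N : Matrix ι ι K} {μ : K} {v : ι → K}
    (h : N.mulVec v = μ • v) (f : R[X]) : (aeval N f).mulVec v = aeval μ f • v := by
  rw [aeval_eq_sum_range, aeval_eq_sum_range, Matrix.sum_mulVec, Finset.sum_smul]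
  refine Finset.sum_congr rfl fun k _ => ?_
  rw [Matrix.smul_mulVec, Matrix.pow_mulVec_eq_smul h, smul_assoc]

/-- A real endomorphism with bounded orbits has all its complex eigenvalues in the unit disc. -/
theorem LinearMap.norm_le_one_of_isRoot_charpoly {m : ℕ} {B : (Fin m → ℝ) →ₗ[ℝ] (Fin m → ℝ)}
    (hB : ∀ x, ∃ K, ∀ k : ℕ, ‖(B ^ k) x‖ ≤ K) {μ : ℂ}
    (hμ : (B.charpoly.map (algebraMap ℝ ℂ)).IsRoot μ) : ‖μ‖ ≤ 1 := by
  by_contra! hgt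
  have hN : B = Matrix.toLin' (LinearMap.toMatrix' B) := (Matrix.toLin'_toMatrix' B).symm
  set N := LinearMap.toMatrix' B
  rw [hN, Matrix.charpoly_toLin', ← Matrix.charpoly_map] at hμ
  obtain ⟨w, hw0, hw⟩ := Matrix.exists_mulVec_eq_smul_of_isRoot_charpoly hμ
  obtain ⟨j, hj⟩ := Function.ne_iff.1 hw0
  obtain ⟨K₁, hK₁⟩ := hB fun i => (w i).re
  obtain ⟨K₂, hK₂⟩ := hB fun i => (w i).im
  have hBk : ∀ (k : ℕ) x, (B ^ k) x = (N ^ k).mulVec x := fun k x => by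
    rw [hN, ← Matrix.toLin'_pow, Matrix.toLin'_apply]
  -- The `j`-th entry of the `k`-th iterate of `w` is `μ ^ k * w j`, and the orbits of the real and
  -- imaginary parts of `w` bound it.
  have hbound : ∀ k : ℕ, ‖μ‖ ^ k * ‖w j‖ ≤ K₁ + K₂ := by
    intro k
    have h1 := congrFun (Matrix.pow_mulVec_eq_smul hw k) j
    have h2 : (N.map (algebraMap ℝ ℂ)) ^ k = (N ^ k).map (algebraMap ℝ ℂ) :=
      (map_pow (algebraMap ℝ ℂ).mapMatrix N k).symm
    rw [h2] at h1
    have hre : (((N ^ k).map (algebraMap ℝ ℂ)).mulVec w j).re = (B ^ k) (fun i => (w i).re) j := by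
      rw [hBk]; simp [Matrix.mulVec, dotProduct]
    have him : (((N ^ k).map (algebraMap ℝ ℂ)).mulVec w j).im = (B ^ k) (fun i => (w i).im) j := by
      rw [hBk]; simp [Matrix.mulVec, dotProduct]
    have h3 := Complex.norm_le_abs_re_add_abs_im (((N ^ k).map (algebraMap ℝ ℂ)).mulVec w j)
    rw [hre, him, h1, Pi.smul_apply, smul_eq_mul, norm_mul, norm_pow] at h3
    have h4 := (norm_le_pi_norm ((B ^ k) fun i => (w i).re) j).trans (hK₁ k)
    have h5 := (norm_le_pi_norm ((B ^ k) fun i => (w i).im) j).trans (hK₂ k)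
    rw [Real.norm_eq_abs] at h4 h5
    linarith
  obtain ⟨k, hk⟩ := pow_unbounded_of_one_lt ((K₁ + K₂) / ‖w j‖) hgt
  rw [div_lt_iff₀ (norm_pos_iff.2 hj)] at hk
  exact absurd (hbound k) (not_le.2 hk)

end Eigenvalues

/-! ### The necessary conditions on the spectrum. -/

section NecessityMain

open Polynomial

variable {n : ℕ}

theorem Matrix.mem_spectrum_complexified_iff (A : Matrix (Fin n) (Fin n) ℝ) (z : ℂ) :
    z ∈ spectrum ℂ A.complexified ↔ 0 < A.eigenMultiplicity z := by
  rw [Matrix.mem_spectrum_iff_isRoot_charpoly, Matrix.eigenMultiplicity,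
    rootMultiplicity_pos (Matrix.charpoly_monic _).ne_zero]

/-- The integral characteristic polynomial factors as `χ_A χ_B`. Weak inequalities come from
comparing multiplicities along a conjugacy class; strictness needs aperiodicity. -/
theorem CutAndProjectScheme.spectrum_of_mulVec_image_subset {m : ℕ} (Λ : CutAndProjectScheme n m)
    (hΛ : Λ.Generic) {Ω : Set (Fin m → ℝ)} (hΩ : IsAcceptanceWindow Ω)
    (A : Matrix (Fin n) (Fin n) ℝ) (hA : A.mulVec '' Λ.projectedSet Ω ⊆ Λ.projectedSet Ω) :
    (∀ z ∈ spectrum ℂ A.complexified, IsIntegral ℤ z) ∧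
      ∀ μ : ℂ, 1 < ‖μ‖ → (∃ z ∈ spectrum ℂ A.complexified, IsConjRoot ℚ μ z) →
        μ ∈ spectrum ℂ A.complexified ∧
        (∀ ν : ℂ, IsConjRoot ℚ ν μ → A.eigenMultiplicity ν ≤ A.eigenMultiplicity μ) ∧
        ∃ ν : ℂ, IsConjRoot ℚ ν μ ∧ A.eigenMultiplicity ν < A.eigenMultiplicity μ := by
  obtain ⟨l, M, B, hl, hM, hB⟩ := Λ.exists_integral_extension hΛ hΩ A hA
  have hχ : M.charpoly.map (algebraMap ℤ ℂ) =
      A.complexified.charpoly * B.charpoly.map (algebraMap ℝ ℂ) := by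
    have h1 := LinearMap.charpoly_toMatrix (A.mulVecLin.prodMap B) l
    rw [hM, Matrix.charpoly_map, LinearMap.charpoly_prodMap, ← Matrix.toLin'_apply',
      Matrix.charpoly_toLin'] at h1
    rw [Matrix.complexified, Matrix.charpoly_map, ← Polynomial.map_mul, ← h1, Polynomial.map_map]
    rfl
  have hχ0 : M.charpoly.map (algebraMap ℤ ℂ) ≠ 0 := (M.charpoly_monic.map _).ne_zero
  let mB : ℂ → ℕ := fun z => (B.charpoly.map (algebraMap ℝ ℂ)).rootMultiplicity z
  have hmul : ∀ z, (M.charpoly.map (algebraMap ℤ ℂ)).rootMultiplicity z =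
      A.eigenMultiplicity z + mB z := fun z => by
    rw [hχ, rootMultiplicity_mul (hχ ▸ hχ0)]; rfl
  have hB0 : B.charpoly.map (algebraMap ℝ ℂ) ≠ 0 := (B.charpoly_monic.map _).ne_zero
  have hmB : ∀ z, 1 < ‖z‖ → mB z = 0 := fun z hz => rootMultiplicity_eq_zero fun h =>
    absurd (LinearMap.norm_le_one_of_isRoot_charpoly hB h) (not_le.2 hz)
  have hconj : ∀ {x y : ℂ}, IsConjRoot ℚ x y →
      A.eigenMultiplicity x + mB x = A.eigenMultiplicity y + mB y := fun h => by
    rw [← hmul, ← hmul, rootMultiplicity_map_eq_of_isConjRoot M.charpoly_monic.ne_zero h]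
  have hintegral : ∀ z ∈ spectrum ℂ A.complexified, IsIntegral ℤ z := by
    intro z hz
    rw [Matrix.mem_spectrum_complexified_iff] at hz
    refine ⟨M.charpoly, M.charpoly_monic, ?_⟩
    rw [← eval_map, ← IsRoot.def, ← rootMultiplicity_pos hχ0, hmul]
    omega
  refine ⟨hintegral, fun μ hμ ⟨z, hz, hμz⟩ => ?_⟩
  have hspec : μ ∈ spectrum ℂ A.complexified := by
    rw [Matrix.mem_spectrum_complexified_iff] at hz ⊢
    have := hconj hμz
    have := hmB μ hμ
    omega
  refine ⟨hspec, fun ν hν => ?_, ?_⟩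
  · have := hconj hν
    have := hmB μ hμ
    omega
  by_contra! hcon
  have hint := hintegral μ hspec
  -- Without strictness, `m_A` is at least `m_A(μ)` on the whole class, where `m_A + m_B` equals
  -- `m_A(μ)`. This leaves no room for `B`.
  have hmB0 : ∀ ν, IsConjRoot ℚ ν μ → mB ν = 0 := fun ν hν => by
    have := hconj hν
    have := hmB μ hμ
    have := hcon ν hν
    omega
  let f := minpoly ℤ μ
  have hfQ : minpoly ℚ μ = f.map (algebraMap ℤ ℚ) :=
    minpoly.isIntegrallyClosed_eq_field_fractions' ℚ hint
  -- an integral vector killed by `f`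
  obtain ⟨z, hz0, hz⟩ : ∃ z ≠ 0, (aeval M f).mulVec z = 0 := by
    rw [Matrix.exists_mulVec_eq_zero_iff]
    have hroot : (M.map (algebraMap ℤ ℂ)).charpoly.IsRoot μ := by
      rw [Matrix.charpoly_map, ← rootMultiplicity_pos hχ0, hmul]
      have := (Matrix.mem_spectrum_complexified_iff A μ).1 hspec
      omega
    obtain ⟨w, hw0, hw⟩ := Matrix.exists_mulVec_eq_smul_of_isRoot_charpoly hroot
    have h1 : (aeval (M.map (algebraMap ℤ ℂ)) f).det = 0 := by
      rw [← Matrix.exists_mulVec_eq_zero_iff]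
      exact ⟨w, hw0, by rw [Matrix.aeval_mulVec_eq_smul hw, minpoly.aeval, zero_smul]⟩
    have h2 : aeval (M.map (algebraMap ℤ ℂ)) f = (aeval M f).map (algebraMap ℤ ℂ) :=
      aeval_algHom_apply (Algebra.ofId ℤ ℂ).mapMatrix M f
    rw [h2] at h1
    have h3 := RingHom.map_det (algebraMap ℤ ℂ) (aeval M f)
    rw [RingHom.mapMatrix_apply, h1] at h3
    exact (algebraMap ℤ ℂ).injective_int (by rw [h3, map_zero])
  -- the corresponding lattice vector has zero internal part
  let v := ∑ i, (z i : ℝ) • l i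
  have hrepr : ∀ i, l.repr v i = z i := fun i => by
    exact congrFun (l.repr_sum_self fun i => (z i : ℝ)) i
  have hvL : v ∈ Λ.lattice := by
    rw [hl]
    refine Submodule.sum_mem _ fun i _ => ?_
    rw [Int.cast_smul_eq_zsmul]
    exact Submodule.smul_mem _ _ (Submodule.subset_span ⟨i, rfl⟩)
  have hfv : (aeval (A.mulVecLin.prodMap B) f) v = 0 := by
    apply l.repr.injective
    ext i
    rw [map_zero, ← LinearMap.toMatrix_mulVec_repr l l]
    have h1 : LinearMap.toMatrix l l (aeval (A.mulVecLin.prodMap B) f) =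
        (aeval M f).map (Int.castRingHom ℝ) := by
      have h2 : LinearMap.toMatrix l l (aeval (A.mulVecLin.prodMap B) f) =
          aeval (LinearMap.toMatrix l l (A.mulVecLin.prodMap B)) f :=
        (aeval_algHom_apply ((LinearMap.toMatrixAlgEquiv l).toAlgHom.restrictScalars ℤ) _ f).symm
      rw [h2, hM]
      exact aeval_algHom_apply (Algebra.ofId ℤ ℝ).mapMatrix M f
    have h2 := congrFun (congrArg (fun u : Fin (n + m) → ℤ => fun i => ((u i : ℤ) : ℝ)) hz) i
    rw [h1]
    simpa [Matrix.mulVec, dotProduct, hrepr] using h2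
  have hfB : (aeval B f) v.2 = 0 := by
    have h1 : ∀ g : ℤ[X], (aeval (A.mulVecLin.prodMap B) g) v =
        ((aeval A.mulVecLin g) v.1, (aeval B g) v.2) := fun g => by
      induction g using Polynomial.induction_on' with
      | add p q hp hq => simp only [map_add, LinearMap.add_apply, hp, hq, Prod.mk_add_mk]
      | monomial k a =>
        rw [aeval_monomial, aeval_monomial, aeval_monomial]
        have : (A.mulVecLin.prodMap B) ^ k = (A.mulVecLin ^ k).prodMap (B ^ k) := by
          induction k with
          | zero => rfl
          | succ k ih => rw [pow_succ, ih, pow_succ, pow_succ]; rfl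
        rw [this]
        simp
    rw [h1] at hfv
    exact congrArg Prod.snd hfv
  -- A common root would be a conjugate of `μ` and an eigenvalue of `B`. A Bézout relation evaluated
  -- at `B` then annihilates `v.2`.
  have hcop : IsCoprime (f.map (algebraMap ℤ ℝ)) B.charpoly := by
    refine (isCoprime_iff_aeval_ne_zero_of_isAlgClosed ℝ ℂ _ _).2 fun a => ?_
    by_contra! h
    have ha : IsConjRoot ℚ a μ := by
      refine (minpoly.eq_of_irreducible_of_monic (minpoly.irreducible
        (hint.tower_top (A := ℚ))) ?_ (minpoly.monic (hint.tower_top (A := ℚ)))).symm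
      rw [hfQ, aeval_map_algebraMap, ← h.1, aeval_map_algebraMap]
    have h1 := hmB0 a ha
    have h2 := (rootMultiplicity_pos hB0 (x := a)).2 (by
      rw [IsRoot.def, eval_map_algebraMap, h.2])
    exact absurd h1 h2.ne'
  obtain ⟨a, b, hab⟩ := hcop
  have hv2 : v.2 = 0 := by
    have h1 := congrArg (fun q => aeval B q v.2) hab
    rw [map_add, map_mul, map_mul, LinearMap.aeval_self_charpoly, aeval_map_algebraMap, mul_zero,
      add_zero, Module.End.mul_apply, hfB, map_zero, map_one, Module.End.one_apply] at h1
    exact h1.symm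
  have hv0 : v = 0 := hΛ.2.1 hvL Λ.lattice.zero_mem (by rw [hv2]; rfl)
  apply hz0
  funext i
  have := hrepr i
  rw [hv0, map_zero] at this
  simpa using this.symm

end NecessityMain

/-! ### Integral blocks with irreducible characteristic polynomial. -/

section IrreducibleBlocks

open Polynomial

theorem Matrix.aeval_transpose' {ι R K : Type*} [Fintype ι] [DecidableEq ι] [CommRing R]
    [CommRing K] [Algebra R K] (N : Matrix ι ι K) (f : R[X]) :
    aeval N.transpose f = (aeval N f).transpose := by
  simp only [aeval_eq_sum_range, Matrix.transpose_sum, Matrix.transpose_smul,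
    Matrix.transpose_pow]

theorem Matrix.aeval_vecMul_eq_smul {ι R K : Type*} [Fintype ι] [DecidableEq ι] [CommRing R]
    [CommRing K] [Algebra R K] {N : Matrix ι ι K} {μ : K} {v : ι → K}
    (h : Matrix.vecMul v N = μ • v) (f : R[X]) : Matrix.vecMul v (aeval N f) = aeval μ f • v := by
  rw [← Matrix.mulVec_transpose] at h ⊢
  rw [← Matrix.aeval_transpose', Matrix.aeval_mulVec_eq_smul h]

/-- A rational vector is not orthogonal to a complex left eigenvector of a rational matrix which
generates a field. -/
theorem Matrix.dotProduct_ne_zero_of_irreducible {d : ℕ} {N : Matrix (Fin d) (Fin d) ℚ} {f : ℚ[X]}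
    (hf : Irreducible f) (hd : f.natDegree = d) (hN : aeval N f = 0) {z : Fin d → ℚ} (hz : z ≠ 0)
    {u : Fin d → ℂ} (hu : u ≠ 0) {ρ : ℂ}
    (hρ : Matrix.vecMul u (N.map (algebraMap ℚ ℂ)) = ρ • u) :
    u ⬝ᵥ (fun i => (z i : ℂ)) ≠ 0 := by
  intro h0
  -- Irreducibility makes `z` cyclic for `N`. As `u` is a left eigenvector, `u ⬝ᵥ z = 0` would make
  -- `u` orthogonal to every `a(N) z`, hence to every basis vector.
  let T : degreeLT ℚ d →ₗ[ℚ] (Fin d → ℚ) :=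
    { toFun := fun a => (aeval N (a : ℚ[X])).mulVec z
      map_add' := fun a b => by rw [Submodule.coe_add, map_add, Matrix.add_mulVec]
      map_smul' := fun c a => by
        rw [Submodule.coe_smul, map_smul, Matrix.smul_mulVec, RingHom.id_apply] }
  have hTi : Function.Injective T := by
    rw [injective_iff_map_eq_zero]
    intro a ha
    by_contra ha0
    have hcop : IsCoprime f (a : ℚ[X]) := by
      refine hf.coprime_iff_not_dvd.2 fun hdvd => ?_
      have h1 := degree_le_of_dvd hdvd (fun h => ha0 (Subtype.ext h))
      rw [degree_eq_natDegree hf.ne_zero, hd] at h1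
      exact absurd (mem_degreeLT.1 a.2) (not_lt.2 h1)
    obtain ⟨s, t, hst⟩ := hcop
    apply hz
    have h1 := congrArg (fun q => (aeval N q).mulVec z) hst
    simp only [map_add, map_mul, hN, mul_zero, zero_add, map_one, Matrix.one_mulVec] at h1
    rw [← Matrix.mulVec_mulVec] at h1
    rw [← h1]
    exact (congrArg _ ha).trans (Matrix.mulVec_zero _)
  have hTs : Function.Surjective T := by
    refine (LinearMap.injective_iff_surjective_of_finrank_eq_finrank ?_).1 hTi
    rw [(degreeLTEquiv ℚ d).finrank_eq]
  apply hu
  funext i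
  obtain ⟨a, ha⟩ := hTs (Pi.single i 1)
  have h1 : (aeval (N.map (algebraMap ℚ ℂ)) (a : ℚ[X])) =
      (aeval N (a : ℚ[X])).map (algebraMap ℚ ℂ) :=
    aeval_algHom_apply (Algebra.ofId ℚ ℂ).mapMatrix N _
  have h2 := congrArg (fun w => w ⬝ᵥ (fun i => (z i : ℂ)))
    (Matrix.aeval_vecMul_eq_smul hρ (a : ℚ[X]))
  simp only [smul_dotProduct, h0, smul_zero] at h2
  rw [h1, ← Matrix.dotProduct_mulVec] at h2
  have h3 : ((aeval N (a : ℚ[X])).map (algebraMap ℚ ℂ)).mulVec (fun i => (z i : ℂ)) =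
      Pi.single i 1 := by
    funext j
    have h4 : (aeval N (a : ℚ[X])).mulVec z = Pi.single i 1 := ha
    have h5 := congrArg (algebraMap ℚ ℂ) (congrFun h4 j)
    rw [Matrix.mulVec, dotProduct, map_sum] at h5
    simp only [map_mul, Pi.single_apply, apply_ite (algebraMap ℚ ℂ), map_one, map_zero] at h5
    simpa [Matrix.mulVec, dotProduct, Pi.single_apply] using h5
  rw [h3] at h2
  simpa using h2

/-- The multiplication by a root of an irreducible monic integral polynomial: an integral matrix
with explicitly given left and right eigenvectors `R`, `U`, none of which is orthogonal to a nonzero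
integral vector. -/
theorem Polynomial.exists_integral_matrix_of_irreducible {f : ℤ[X]} (hm : f.Monic)
    (hf : Irreducible f) :
    ∃ (M : Matrix (Fin f.natDegree) (Fin f.natDegree) ℤ)
      (R U : Matrix (Fin f.natDegree) (Fin f.natDegree) ℂ) (α : Fin f.natDegree → ℂ),
      R * U = 1 ∧ R * M.map (algebraMap ℤ ℂ) = Matrix.diagonal α * R ∧ Function.Injective α ∧
      (∀ ν, aeval ν f = 0 ↔ ∃ k, α k = ν) ∧
      (∀ z : Fin f.natDegree → ℤ, z ≠ 0 → ∀ k, (R.mulVec fun i => (z i : ℂ)) k ≠ 0) ∧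
      (∀ z : Fin f.natDegree → ℤ, z ≠ 0 → ∀ k, (Matrix.vecMul (fun i => (z i : ℂ)) U) k ≠ 0) := by
  classical
  let fQ := f.map (algebraMap ℤ ℚ)
  have hfQ : Irreducible fQ := (hm.irreducible_iff_irreducible_map_fraction_map).1 hf
  have hdeg : fQ.natDegree = f.natDegree := hm.natDegree_map _
  have hcard : Fintype.card (fQ.rootSet ℂ) = f.natDegree := by
    rw [← hdeg]
    exact card_rootSet_eq_natDegree hfQ.separable (IsAlgClosed.splits _)
  let eqv := Fintype.equivFinOfCardEq hcard
  let α : Fin f.natDegree → ℂ := fun k => (eqv.symm k : ℂ)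
  have hα : Function.Injective α := Subtype.val_injective.comp eqv.symm.injective
  have hroot : ∀ ν, aeval ν f = 0 ↔ ∃ k, α k = ν := by
    intro ν
    have h1 : aeval ν f = 0 ↔ ν ∈ fQ.rootSet ℂ := by
      rw [mem_rootSet_of_ne hfQ.ne_zero, aeval_map_algebraMap]
    rw [h1]
    exact ⟨fun h => ⟨eqv ⟨ν, h⟩, by simp [α]⟩, by rintro ⟨k, rfl⟩; exact (eqv.symm k).2⟩
  let b := AdjoinRoot.powerBasisAux' hm
  have hb : ∀ i, b i = AdjoinRoot.root f ^ (i : ℕ) := fun i =>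
    (AdjoinRoot.powerBasis' hm).basis_eq_pow i
  let M := Algebra.leftMulMatrix b (AdjoinRoot.root f)
  have hM : aeval M f = 0 := by
    rw [aeval_algHom_apply, AdjoinRoot.aeval_eq, AdjoinRoot.mk_self, map_zero]
  -- Row `k` lists the values on the power basis of the embedding that sends the root to `α k`, so
  -- it is a left eigenvector of multiplication by the root.
  let R : Matrix (Fin f.natDegree) (Fin f.natDegree) ℂ := Matrix.vandermonde α
  have hR : IsUnit R.det := (Matrix.det_vandermonde_ne_zero_iff.2 hα).isUnit
  have hRM : R * M.map (algebraMap ℤ ℂ) = Matrix.diagonal α * R := by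
    ext k j
    have hk : eval₂ (algebraMap ℤ ℂ) (α k) f = 0 := (hroot _).2 ⟨k, rfl⟩
    let φ := AdjoinRoot.lift (algebraMap ℤ ℂ) (α k) hk
    have hφ : ∀ i, φ (b i) = α k ^ (i : ℕ) := fun i => by
      rw [hb, map_pow, AdjoinRoot.lift_root]
    have h1 := congrArg φ (b.sum_repr (AdjoinRoot.root f * b j))
    rw [map_sum, map_mul φ, hφ, AdjoinRoot.lift_root] at h1
    rw [Matrix.diagonal_mul, Matrix.mul_apply]
    simp only [R, Matrix.vandermonde_apply, Matrix.map_apply, M, Algebra.leftMulMatrix_eq_repr_mul]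
    rw [← h1]
    refine Finset.sum_congr rfl fun i _ => ?_
    rw [map_zsmul, hφ, zsmul_eq_mul, mul_comm]
    rfl
  have hRU : R * R⁻¹ = 1 := Matrix.mul_nonsing_inv _ hR
  have hUR : R⁻¹ * R = 1 := Matrix.nonsing_inv_mul _ hR
  have hMU : M.map (algebraMap ℤ ℂ) * R⁻¹ = R⁻¹ * Matrix.diagonal α := by
    calc _ = R⁻¹ * R * M.map (algebraMap ℤ ℂ) * R⁻¹ := by rw [hUR, Matrix.one_mul]
      _ = R⁻¹ * (R * M.map (algebraMap ℤ ℂ)) * R⁻¹ := by simp only [Matrix.mul_assoc]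
      _ = R⁻¹ * Matrix.diagonal α * (R * R⁻¹) := by rw [hRM]; simp only [Matrix.mul_assoc]
      _ = _ := by rw [hRU, Matrix.mul_one]
  let N := M.map (algebraMap ℤ ℚ)
  have hN : aeval N fQ = 0 := by
    rw [aeval_map_algebraMap]
    have := aeval_algHom_apply (Algebra.ofId ℤ ℚ).mapMatrix M f
    rw [hM, map_zero] at this
    exact this
  have hNC : N.map (algebraMap ℚ ℂ) = M.map (algebraMap ℤ ℂ) := by
    ext i j; simp [N]
  have hcast : ∀ z : Fin f.natDegree → ℤ, z ≠ 0 → (fun i => (z i : ℚ)) ≠ 0 := fun z hz h =>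
    hz (_root_.funext fun i => by simpa using congrFun h i)
  refine ⟨M, R, R⁻¹, α, hRU, hRM, hα, hroot, fun z hz k => ?_, fun z hz k => ?_⟩
  · have h1 : Matrix.vecMul (R k) (N.map (algebraMap ℚ ℂ)) = α k • R k := by
      rw [hNC]
      have := congrFun hRM k
      rw [Matrix.mul_apply_eq_vecMul] at this
      rw [this]
      ext j
      simp [Matrix.diagonal_mul]
    have h2 : R k ≠ 0 := fun h => by
      have := congrFun (congrFun hRU k) k
      rw [Matrix.mul_apply_eq_vecMul, h] at this
      simp at this
    have h3 := Matrix.dotProduct_ne_zero_of_irreducible hfQ hdeg hN (hcast z hz) h2 h1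
    simpa [Matrix.mulVec] using h3
  · have h1 : Matrix.vecMul (fun i => R⁻¹ i k) (N.transpose.map (algebraMap ℚ ℂ)) =
        α k • fun i => R⁻¹ i k := by
      have hNT : N.transpose.map (algebraMap ℚ ℂ) = (M.map (algebraMap ℤ ℂ)).transpose := by
        rw [← hNC]; rfl
      rw [hNT, Matrix.vecMul_transpose]
      ext i
      have := congrFun (congrFun hMU i) k
      rw [Matrix.mul_diagonal, Matrix.mul_apply] at this
      rw [Pi.smul_apply, smul_eq_mul, mul_comm, ← this]
      rfl
    have h2 : (fun i => R⁻¹ i k) ≠ 0 := fun h => by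
      have := congrFun (congrFun hRU k) k
      rw [Matrix.mul_apply] at this
      have h' : ∀ i, R⁻¹ i k = 0 := congrFun h
      simp [h'] at this
    have h3 := Matrix.dotProduct_ne_zero_of_irreducible hfQ hdeg
      (N := N.transpose) (by rw [Matrix.aeval_transpose', hN, Matrix.transpose_zero])
      (hcast z hz) h2 h1
    rw [dotProduct_comm] at h3
    simpa [Matrix.vecMul] using h3

end IrreducibleBlocks

/-! ### The integral matrix extending the spectrum of `A`. -/

section IntegralModel

open Polynomial

theorem Matrix.blockDiagonal'_mulVec_apply {o K : Type*} {m : o → Type*} [Fintype o]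
    [DecidableEq o] [∀ i, Fintype (m i)] [NonUnitalNonAssocSemiring K]
    (M : ∀ i, Matrix (m i) (m i) K) (v : (Σ i, m i) → K) (i : o) (k : m i) :
    (Matrix.blockDiagonal' M).mulVec v ⟨i, k⟩ = (M i).mulVec (fun k => v ⟨i, k⟩) k := by
  rw [Matrix.mulVec, dotProduct, Fintype.sum_sigma, Finset.sum_eq_single i]
  · simp [Matrix.mulVec, dotProduct]
  · intro j _ hj
    simp [Matrix.blockDiagonal'_apply_ne M _ _ hj.symm]
  · simp

theorem Matrix.vecMul_blockDiagonal'_apply {o K : Type*} {m : o → Type*} [Fintype o]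
    [DecidableEq o] [∀ i, Fintype (m i)] [NonUnitalNonAssocSemiring K]
    (M : ∀ i, Matrix (m i) (m i) K) (v : (Σ i, m i) → K) (i : o) (k : m i) :
    Matrix.vecMul v (Matrix.blockDiagonal' M) ⟨i, k⟩ = Matrix.vecMul (fun k => v ⟨i, k⟩) (M i) k := by
  rw [Matrix.vecMul, dotProduct, Fintype.sum_sigma, Finset.sum_eq_single i]
  · simp [Matrix.vecMul, dotProduct]
  · intro j _ hj
    simp [Matrix.blockDiagonal'_apply_ne M _ _ hj]
  · simp

/-- An integral matrix `C`, diagonalized by `R` with inverse `U`, whose spectrum extends the given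
family `d` of algebraic integers (through `e`) by numbers of the closed unit disc. Each nonzero
integral vector has a nonzero component for an eigenvalue in `d`, and one for an eigenvalue having
an eigenvector outside the range of `e`. -/
theorem exists_integral_model {n : ℕ} (d : Fin n → ℂ) (hint : ∀ j, IsIntegral ℤ (d j))
    (hd : ∀ μ : ℂ, 1 < ‖μ‖ → (∃ j, IsConjRoot ℚ μ (d j)) →
      (∀ ν : ℂ, IsConjRoot ℚ ν μ → Nat.card {j // d j = ν} ≤ Nat.card {j // d j = μ}) ∧
      ∃ ν : ℂ, IsConjRoot ℚ ν μ ∧ Nat.card {j // d j = ν} < Nat.card {j // d j = μ}) :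
    ∃ (σ : Type) (_ : Fintype σ) (_ : DecidableEq σ) (C : Matrix σ σ ℤ) (R U : Matrix σ σ ℂ)
      (D : σ → ℂ) (e : Fin n → σ),
      R * U = 1 ∧ R * C.map (algebraMap ℤ ℂ) = Matrix.diagonal D * R ∧ Function.Injective e ∧
      (∀ j, D (e j) = d j) ∧ (∀ a, a ∉ Set.range e → ‖D a‖ ≤ 1) ∧
      (∀ z : σ → ℤ, z ≠ 0 → ∃ j a, D a = d j ∧ (R.mulVec fun i => (z i : ℂ)) a ≠ 0) ∧
      (∀ z : σ → ℤ, z ≠ 0 → ∃ j a, D a = d j ∧ (Matrix.vecMul (fun i => (z i : ℂ)) U) a ≠ 0) ∧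
      (∀ z : σ → ℤ, z ≠ 0 → ∃ a b, D a = D b ∧ (R.mulVec fun i => (z i : ℂ)) a ≠ 0 ∧
        b ∉ Set.range e) := by
  classical
  let F := Set.range fun j => minpoly ℤ (d j)
  let mult : ℂ → ℕ := fun z => Nat.card {j // d j = z}
  have hFm : ∀ f : F, (f : ℤ[X]).Monic := by
    rintro ⟨_, j, rfl⟩; exact minpoly.monic (hint j)
  have hFi : ∀ f : F, Irreducible (f : ℤ[X]) := by
    rintro ⟨_, j, rfl⟩; exact minpoly.irreducible (hint j)
  choose M R U α hRU hRM hα hroot hR hU using fun f : F =>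
    exists_integral_matrix_of_irreducible (hFm f) (hFi f)
  have hmin : ∀ (f : F) (ν : ℂ), aeval ν (f : ℤ[X]) = 0 → IsIntegral ℤ ν ∧ minpoly ℤ ν = f := by
    intro f ν hν
    have h1 : IsIntegral ℤ ν := ⟨f, hFm f, hν⟩
    refine ⟨h1, eq_of_monic_of_associated (minpoly.monic h1) (hFm f) ?_⟩
    exact (minpoly.irreducible h1).associated_of_dvd (hFi f)
      (minpoly.isIntegrallyClosed_dvd h1 hν)
  have hconj : ∀ (f : F) (ν ν' : ℂ), aeval ν (f : ℤ[X]) = 0 → aeval ν' (f : ℤ[X]) = 0 →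
      IsConjRoot ℚ ν ν' := by
    intro f ν ν' h h'
    rw [isConjRoot_def, minpoly.isIntegrallyClosed_eq_field_fractions' ℚ (hmin f ν h).1,
      minpoly.isIntegrallyClosed_eq_field_fractions' ℚ (hmin f ν' h').1, (hmin f ν h).2,
      (hmin f ν' h').2]
  have hconj' : ∀ (f : F) (ν ν' : ℂ), aeval ν (f : ℤ[X]) = 0 → IsConjRoot ℚ ν' ν →
      aeval ν' (f : ℤ[X]) = 0 := by
    intro f ν ν' h h'
    rw [isConjRoot_def, minpoly.isIntegrallyClosed_eq_field_fractions' ℚ (hmin f ν h).1,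
      (hmin f ν h).2] at h'
    rw [← aeval_map_algebraMap ℚ, ← h', minpoly.aeval]
  have hdF : ∀ f : F, ∃ j, aeval (d j) (f : ℤ[X]) = 0 := by
    rintro ⟨_, j, rfl⟩; exact ⟨j, minpoly.aeval ℤ (d j)⟩
  -- The number of blocks for `f`. Roots outside the disc share the maximal multiplicity, so the
  -- choice is immaterial. The default `n + 1` exceeds every multiplicity, so in both cases some
  -- root has multiplicity less than `k f`.
  let k : F → ℕ := fun f =>
    if h : ∃ μ : ℂ, 1 < ‖μ‖ ∧ aeval μ (f : ℤ[X]) = 0 then mult h.choose else n + 1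
  have hmultn : ∀ z, mult z < n + 1 := fun z => by
    have := Finite.card_subtype_le fun j => d j = z
    simp only [Nat.card_eq_fintype_card, Fintype.card_fin] at this
    simpa [mult, Nat.card_eq_fintype_card] using Nat.lt_succ_of_le this
  have hdf : ∀ (f : F) (μ : ℂ), 1 < ‖μ‖ → aeval μ (f : ℤ[X]) = 0 →
      (∀ ν : ℂ, aeval ν (f : ℤ[X]) = 0 → mult ν ≤ mult μ) ∧
      ∃ ν : ℂ, aeval ν (f : ℤ[X]) = 0 ∧ mult ν < mult μ := by
    intro f μ hμ hf
    obtain ⟨j, hj⟩ := hdF f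
    obtain ⟨h1, ν, h2, h3⟩ := hd μ hμ ⟨j, hconj f _ _ hf hj⟩
    exact ⟨fun ν hν => h1 ν (hconj f _ _ hν hf), ν, hconj' f _ _ hf h2, h3⟩
  have hk_le : ∀ (f : F) (ν : ℂ), aeval ν (f : ℤ[X]) = 0 → mult ν ≤ k f := by
    intro f ν hν
    by_cases h : ∃ μ : ℂ, 1 < ‖μ‖ ∧ aeval μ (f : ℤ[X]) = 0
    · simp only [k, dif_pos h]
      exact (hdf f _ h.choose_spec.1 h.choose_spec.2).1 ν hν
    · simp only [k, dif_neg h]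
      exact (hmultn ν).le
  have hk_gt : ∀ (f : F) (ν : ℂ), 1 < ‖ν‖ → aeval ν (f : ℤ[X]) = 0 → k f ≤ mult ν := by
    intro f ν hν1 hν
    have h : ∃ μ : ℂ, 1 < ‖μ‖ ∧ aeval μ (f : ℤ[X]) = 0 := ⟨ν, hν1, hν⟩
    simp only [k, dif_pos h]
    exact (hdf f ν hν1 hν).1 _ h.choose_spec.2
  have hk_lt : ∀ f : F, ∃ ν : ℂ, aeval ν (f : ℤ[X]) = 0 ∧ mult ν < k f := by
    intro f
    by_cases h : ∃ μ : ℂ, 1 < ‖μ‖ ∧ aeval μ (f : ℤ[X]) = 0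
    · simp only [k, dif_pos h]
      exact (hdf f _ h.choose_spec.1 h.choose_spec.2).2
    · simp only [k, dif_neg h]
      obtain ⟨j, hj⟩ := hdF f
      exact ⟨_, hj, hmultn _⟩
  let rk : ∀ z : ℂ, {j // d j = z} ≃ Fin (mult z) := fun z => Finite.equivFin _
  let σ := Σ i : (Σ f : F, Fin (k f)), Fin (i.1 : ℤ[X]).natDegree
  let D : σ → ℂ := fun a => α a.1.1 a.2
  have hD : ∀ a : σ, aeval (D a) (a.1.1 : ℤ[X]) = 0 := fun a => (hroot _ _).2 ⟨a.2, rfl⟩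
  choose ix hix using fun (f : F) (ν : ℂ) (h : aeval ν (f : ℤ[X]) = 0) => (hroot f ν).1 h
  -- the label with a given polynomial, block number and eigenvalue
  let lab : ∀ (f : F) (r : ℕ) (_ : r < k f) (ν : ℂ) (_ : aeval ν (f : ℤ[X]) = 0), σ :=
    fun f r hr ν hν => ⟨⟨f, ⟨r, hr⟩⟩, ix f ν hν⟩
  have hDlab : ∀ f r hr ν hν, D (lab f r hr ν hν) = ν := fun f r hr ν hν => hix f ν hν
  have hlab : ∀ a : σ, a = lab a.1.1 a.1.2 a.1.2.2 (D a) (hD a) := by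
    rintro ⟨⟨f, r⟩, i⟩
    have : i = ix f (α f i) (hD ⟨⟨f, r⟩, i⟩) := hα f (hix f _ _).symm
    simp only [lab]
    congr 1
  have hlab_congr : ∀ {f f' : F} {r r' : ℕ} {ν ν' : ℂ} (hr hr' hν hν'), f = f' → r = r' → ν = ν' →
      lab f r hr ν hν = lab f' r' hr' ν' hν' := by
    rintro f f' r r' ν ν' hr hr' hν hν' rfl rfl rfl; rfl
  let fd : Fin n → F := fun j => ⟨minpoly ℤ (d j), j, rfl⟩
  have hfd : ∀ j, aeval (d j) (fd j : ℤ[X]) = 0 := fun j => minpoly.aeval ℤ (d j)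
  -- The `r`-th index carrying a given eigenvalue is placed in the `r`-th block of its minimal
  -- polynomial.
  let e : Fin n → σ := fun j => lab (fd j) (rk (d j) ⟨j, rfl⟩)
    (lt_of_lt_of_le (Fin.is_lt _) (hk_le _ _ (hfd j))) (d j) (hfd j)
  have hDe : ∀ j, D (e j) = d j := fun j => hDlab _ _ _ _ _
  have hrk : ∀ {j : Fin n} {z : ℂ} (h : d j = z), ((rk (d j) ⟨j, rfl⟩ : Fin _) : ℕ) =
      (rk z ⟨j, h⟩ : Fin _) := by rintro j _ rfl; rfl
  have he2 : ∀ j, ((e j).1.2 : ℕ) = (rk (d j) ⟨j, rfl⟩ : Fin _) := fun j => rfl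
  have hcast : ∀ (z : σ → ℤ), z ≠ 0 → ∃ i : (Σ f : F, Fin (k f)),
      (fun k => z ⟨i, k⟩) ≠ 0 := by
    intro z hz
    obtain ⟨⟨i, l⟩, ha⟩ := Function.ne_iff.1 hz
    exact ⟨i, fun h => ha (congrFun h l)⟩
  have hRz : ∀ (z : σ → ℤ), z ≠ 0 → ∃ i : (Σ f : F, Fin (k f)), ∀ l,
      ((Matrix.blockDiagonal' fun i : (Σ f : F, Fin (k f)) => R i.1).mulVec
        fun i => (z i : ℂ)) ⟨i, l⟩ ≠ 0 := by
    intro z hz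
    obtain ⟨i, hi⟩ := hcast z hz
    refine ⟨i, fun l => ?_⟩
    rw [Matrix.blockDiagonal'_mulVec_apply]
    exact hR i.1 _ hi l
  refine ⟨σ, inferInstance, inferInstance,
    Matrix.blockDiagonal' fun i => M i.1, Matrix.blockDiagonal' fun i => R i.1,
    Matrix.blockDiagonal' fun i => U i.1, D, e, ?_, ?_, ?_, hDe, ?_, ?_, ?_, ?_⟩
  · rw [← Matrix.blockDiagonal'_mul]
    simp only [hRU]
    exact Matrix.blockDiagonal'_one
  · rw [Matrix.blockDiagonal'_map _ _ (map_zero _), ← Matrix.blockDiagonal'_mul]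
    simp only [hRM]
    rw [Matrix.blockDiagonal'_mul, Matrix.blockDiagonal'_diagonal]
  · intro j j' h
    have h1 : d j = d j' := by rw [← hDe, ← hDe, h]
    have h2 : ((rk (d j) ⟨j, rfl⟩ : Fin _) : ℕ) = (rk (d j') ⟨j', rfl⟩ : Fin _) := by
      rw [← he2, ← he2, h]
    rw [hrk h1] at h2
    exact congrArg Subtype.val ((rk (d j')).injective (Fin.ext h2))
  · intro a ha
    by_contra! hgt
    apply ha
    -- An eigenvalue outside the disc occurs in `d` at least as often as there are blocks, so the
    -- block number of `a` is the rank of some index `j`.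
    have h1 := lt_of_lt_of_le a.1.2.2 (hk_gt _ _ hgt (hD a))
    let j := (rk (D a)).symm ⟨a.1.2, h1⟩
    refine ⟨j, ?_⟩
    refine Eq.trans ?_ (hlab a).symm
    refine hlab_congr _ _ _ _ (Subtype.ext ?_) ?_ j.2
    · exact (congrArg (minpoly ℤ) j.2).trans (hmin _ _ (hD a)).2
    · rw [hrk j.2]
      simp [j]
  · intro z hz
    obtain ⟨i, hi⟩ := hRz z hz
    obtain ⟨j, hj⟩ := hdF i.1
    exact ⟨j, ⟨i, ix i.1 (d j) hj⟩, hix _ _ _, hi _⟩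
  · intro z hz
    obtain ⟨i, hi⟩ := hcast z hz
    obtain ⟨j, hj⟩ := hdF i.1
    refine ⟨j, ⟨i, ix i.1 (d j) hj⟩, hix _ _ _, ?_⟩
    rw [Matrix.vecMul_blockDiagonal'_apply]
    exact hU i.1 _ hi _
  · intro z hz
    obtain ⟨i, hi⟩ := hRz z hz
    obtain ⟨ν, hν, hlt⟩ := hk_lt i.1
    -- Ranks of the indices with eigenvalue `ν` are below `mult ν`, so `e` never reaches the block
    -- with that number.
    refine ⟨⟨i, ix i.1 ν hν⟩, lab i.1 (mult ν) hlt ν hν, ?_, hi _, ?_⟩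
    · exact (hix _ _ _).trans (hDlab _ _ _ _ _).symm
    · rintro ⟨j, hj⟩
      have h1 : d j = ν := by rw [← hDe, hj, hDlab]
      have h2 : ((rk (d j) ⟨j, rfl⟩ : Fin _) : ℕ) = mult ν := by rw [← he2, hj]
      rw [hrk h1] at h2
      exact absurd (Fin.is_lt (rk ν ⟨j, h1⟩)) (not_lt.2 h2.ge)

end IntegralModel

/-! ### From intertwiners to a cut-and-project set. -/

section Construction

/-- The set of vectors whose orbit stays in the unit ball is an acceptance window if the orbits
are bounded. -/
theorem isAcceptanceWindow_of_bounded_orbits {m : ℕ} {E : Type*} [NormedAddCommGroup E]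
    [NormedSpace ℝ E] (g : ℕ → (Fin m → ℝ) →L[ℝ] E) (hg : ∀ y, ∃ K, ∀ k, ‖g k y‖ ≤ K)
    (s : E →L[ℝ] (Fin m → ℝ)) (hs : ∀ y, s (g 0 y) = y) :
    IsAcceptanceWindow {y | ∀ k, ‖g k y‖ ≤ 1} := by
  -- A uniform bound places a ball inside the set, which is convex; a convex set with interior
  -- points has the same closure as its interior.
  obtain ⟨K, hK⟩ := banach_steinhaus hg
  have hK0 : 0 ≤ K := (norm_nonneg _).trans (hK 0)
  have hsub : Metric.ball (0 : Fin m → ℝ) (1 / (K + 1)) ⊆ {y | ∀ k, ‖g k y‖ ≤ 1} := by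
    intro y hy k
    rw [mem_ball_zero_iff, lt_div_iff₀ (by positivity)] at hy
    have h1 := (g k).le_of_opNorm_le (hK k) y
    nlinarith [norm_nonneg y]
  have hint : (interior {y | ∀ k, ‖g k y‖ ≤ 1}).Nonempty :=
    ⟨0, interior_mono hsub (by
      rw [Metric.isOpen_ball.interior_eq]; exact Metric.mem_ball_self (by positivity))⟩
  refine ⟨?_, ?_, ?_⟩
  · refine isBounded_iff_forall_norm_le.2 ⟨‖s‖, fun y hy => ?_⟩
    have h1 := s.le_opNorm (g 0 y)
    rw [hs] at h1
    have h2 := mul_le_mul_of_nonneg_left (hy 0) (norm_nonneg s)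
    linarith
  · refine Convex.closure_interior_eq_closure_of_nonempty_interior (𝕜 := ℝ) ?_ hint
    have : {y | ∀ k, ‖g k y‖ ≤ 1} = ⋂ k, (g k) ⁻¹' Metric.closedBall 0 1 := by
      ext y; simp
    rw [this]
    exact convex_iInter fun k => (convex_closedBall _ _).linear_preimage (g k).toLinearMap
  · exact closure_nonempty_iff.2 (hint.mono interior_subset)

/-- A pair of real intertwiners in general position between `A` and an integral matrix `C` with
bounded orbits on the complement gives a cut-and-project set stable under `A`. -/
theorem exists_isCutAndProjectSet_of_intertwiners {n : ℕ} (hn : 1 ≤ n)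
    (A : Matrix (Fin n) (Fin n) ℝ) {σ : Type*} [Fintype σ] [DecidableEq σ] (C : Matrix σ σ ℤ)
    (P : Matrix (Fin n) σ ℝ) (J : Matrix σ (Fin n) ℝ) (hPJ : P * J = 1)
    (hP : A * P = P * C.map (algebraMap ℤ ℝ)) (hJ : C.map (algebraMap ℤ ℝ) * J = J * A)
    (h1 : ∀ z : σ → ℤ, z ≠ 0 → P.mulVec (fun i => (z i : ℝ)) ≠ 0)
    (h2 : ∀ z : σ → ℤ, z ≠ 0 → J.mulVec (P.mulVec fun i => (z i : ℝ)) ≠ fun i => (z i : ℝ))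
    (h3 : ∀ z : σ → ℤ, z ≠ 0 → Matrix.vecMul (fun i => (z i : ℝ)) J ≠ 0)
    (hσ : n < Fintype.card σ)
    (hbd : ∀ x, P.mulVec x = 0 → ∃ K, ∀ k : ℕ,
      ‖(C.map (algebraMap ℤ ℝ) ^ k).mulVec x‖ ≤ K) :
    ∃ S : Set (Fin n → ℝ), IsCutAndProjectSet S ∧ A.mulVec '' S ⊆ S := by
  set CR := C.map (algebraMap ℤ ℝ)
  have hPJv : ∀ x, P.mulVec (J.mulVec x) = x := fun x => by
    rw [Matrix.mulVec_mulVec, hPJ, Matrix.one_mulVec]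
  let V := LinearMap.ker P.mulVecLin
  let m := Module.finrank ℝ V
  let ψ : V ≃ₗ[ℝ] (Fin m → ℝ) := (Module.finBasis ℝ V).equivFun
  let Q : (σ → ℝ) →ₗ[ℝ] V := LinearMap.codRestrict V
    (LinearMap.id - J.mulVecLin.comp P.mulVecLin) fun x => by
      change P.mulVec (x - J.mulVec (P.mulVec x)) = 0
      rw [Matrix.mulVec_sub, hPJv, sub_self]
  have hQ : ∀ x, (Q x : σ → ℝ) = x - J.mulVec (P.mulVec x) := fun x => rfl
  have hQV : ∀ v : V, Q v = v := fun v => by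
    have hv : P.mulVec (v : σ → ℝ) = 0 := v.2
    exact Subtype.ext (by rw [hQ, hv, Matrix.mulVec_zero, sub_zero])
  let T : (Fin m → ℝ) →ₗ[ℝ] (σ → ℝ) := V.subtype.comp ψ.symm.toLinearMap
  have hT : ∀ y, T y = (ψ.symm y : V) := fun y => rfl
  -- The splitting `x = J P x + (x - J P x)` into the image of `J` and `ker P`; the lattice will be
  -- `Φ(ℤ^σ)`.
  let Φ : (σ → ℝ) ≃ₗ[ℝ] (Fin n → ℝ) × (Fin m → ℝ) := LinearEquiv.ofLinearMap
    (P.mulVecLin.prod (ψ.toLinearMap.comp Q)) (J.mulVecLin.coprod T) (by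
      refine LinearMap.ext fun v => Prod.ext ?_ ?_
      · have hv : P.mulVec (T v.2) = 0 := (ψ.symm v.2).2
        simp [Matrix.mulVec_add, hPJv, hv]
      · have h4 : Q (J.mulVec v.1) = 0 := Subtype.ext (by rw [hQ, hPJv, sub_self]; rfl)
        have h5 : Q (T v.2) = ψ.symm v.2 := hQV _
        simp [h4, h5]) (by
      refine LinearMap.ext fun x => ?_
      simp [hT, hQ])
  have hΦ1 : ∀ x, (Φ x).1 = P.mulVec x := fun x => rfl
  have hΦ2 : ∀ x, (Φ x).2 = ψ (Q x) := fun x => rfl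
  have hTΦ : ∀ x, T (Φ x).2 = x - J.mulVec (P.mulVec x) := fun x => by
    rw [hΦ2, hT, ψ.symm_apply_apply, hQ]
  have hcard : Fintype.card σ = n + m := by
    have := Φ.finrank_eq
    simpa using this
  let l : Module.Basis (Fin (n + m)) ℝ ((Fin n → ℝ) × (Fin m → ℝ)) :=
    ((Pi.basisFun ℝ σ).map Φ).reindex (Fintype.equivFinOfCardEq hcard)
  have hrange : Set.range l = Set.range fun i => Φ (Pi.single i 1) := by
    rw [Module.Basis.range_reindex]
    congr 1
    funext i
    simp
  let Λ : CutAndProjectScheme n m := ⟨hn, by omega, Submodule.span ℤ (Set.range l), l, rfl⟩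
  have hmem : ∀ v, v ∈ Λ.lattice ↔ ∃ z : σ → ℤ, v = Φ fun i => (z i : ℝ) := by
    intro v
    constructor
    · intro hv
      change v ∈ Submodule.span ℤ (Set.range l) at hv
      rw [hrange] at hv
      induction hv using Submodule.span_induction with
      | mem x hx =>
        obtain ⟨i, rfl⟩ := hx
        refine ⟨Pi.single i 1, congrArg Φ (funext fun j => ?_)⟩
        by_cases h : j = i
        · subst h; simp
        · simp [h]
      | zero => exact ⟨0, by simp [← Pi.zero_def]⟩
      | add x y _ _ hx hy =>
        obtain ⟨z, rfl⟩ := hx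
        obtain ⟨z', rfl⟩ := hy
        refine ⟨z + z', ?_⟩
        rw [← map_add]
        congr 1
        funext i
        simp
      | smul a x _ hx =>
        obtain ⟨z, rfl⟩ := hx
        refine ⟨a • z, ?_⟩
        rw [← map_zsmul]
        congr 1
        funext i
        simp
    · rintro ⟨z, rfl⟩
      change _ ∈ Submodule.span ℤ (Set.range l)
      rw [hrange, pi_eq_sum_univ' (fun i => (z i : ℝ)), map_sum]
      refine Submodule.sum_mem _ fun i _ => ?_
      rw [map_smul, Int.cast_smul_eq_zsmul]
      refine Submodule.smul_mem _ _ (Submodule.subset_span ⟨i, congrArg Φ (funext fun j => ?_)⟩)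
      simp [Pi.single_apply, eq_comm]
  have hsub : ∀ z z' : σ → ℤ, (fun i => ((z - z') i : ℝ)) =
      (fun i => (z i : ℝ)) - fun i => (z' i : ℝ) := fun z z' => by
    funext i; simp
  have hgen : Λ.Generic := by
    refine ⟨?_, ?_, ?_⟩
    · intro v hv w hw hvw
      obtain ⟨z, rfl⟩ := (hmem _).1 hv
      obtain ⟨z', rfl⟩ := (hmem _).1 hw
      by_contra hne
      refine h1 (z - z') (fun h => hne (by rw [sub_eq_zero.1 h])) ?_
      rw [hΦ1, hΦ1] at hvw
      rw [hsub, Matrix.mulVec_sub, hvw, sub_self]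
    · intro v hv w hw hvw
      obtain ⟨z, rfl⟩ := (hmem _).1 hv
      obtain ⟨z', rfl⟩ := (hmem _).1 hw
      by_contra hne
      refine h2 (z - z') (fun h => hne (by rw [sub_eq_zero.1 h])) ?_
      have h4 := hTΦ ((fun i => (z i : ℝ)) - fun i => (z' i : ℝ))
      rw [map_sub, Prod.snd_sub, hvw, sub_self, map_zero] at h4
      rw [hsub]
      exact (sub_eq_zero.1 h4.symm).symm
    · by_contra hnd
      let G : AddSubgroup (Fin m → ℝ) :=
        Λ.lattice.toAddSubgroup.map (AddMonoidHom.snd (Fin n → ℝ) (Fin m → ℝ))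
      have hspan : Submodule.span ℝ (G : Set (Fin m → ℝ)) = ⊤ := by
        rw [eq_top_iff, ← LinearMap.range_eq_top.2 (LinearMap.snd_surjective (R := ℝ)
          (M := Fin n → ℝ) (M₂ := Fin m → ℝ)), LinearMap.range_eq_map, ← l.span_eq,
          Submodule.map_span]
        refine Submodule.span_mono ?_
        rintro _ ⟨v, hv, rfl⟩
        exact ⟨v, Submodule.subset_span hv, rfl⟩
      obtain ⟨φ, hφ, hφG⟩ := G.exists_integral_functional hspan hnd
      -- If density fails, the integral functional pulls back to an integer row vector `ξ`. It kills
      -- the image of `J`, whose internal part is zero, against `h3`.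
      choose ξ hξ using fun i : σ => hφG (Φ (Pi.single i 1)).2
        ⟨Φ (Pi.single i 1), Submodule.subset_span (hrange ▸ ⟨i, rfl⟩), rfl⟩
      have hφx : ∀ x, φ (Φ x).2 = (fun i => (ξ i : ℝ)) ⬝ᵥ x := by
        intro x
        conv_lhs => rw [pi_eq_sum_univ' x]
        rw [map_sum, Prod.snd_sum, map_sum, dotProduct]
        refine Finset.sum_congr rfl fun i _ => ?_
        rw [map_smul, Prod.smul_snd, map_smul, smul_eq_mul, mul_comm, ← hξ]
      by_cases hξ0 : ξ = 0
      · apply hφ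
        refine LinearMap.ext fun y => ?_
        have := hφx (Φ.symm (0, y))
        rw [Φ.apply_symm_apply] at this
        simpa [hξ0] using this
      · refine h3 ξ hξ0 (funext fun j => ?_)
        have h4 := hφx (J.mulVec (Pi.single j 1))
        have h5 : Q (J.mulVec (Pi.single j 1)) = 0 :=
          Subtype.ext (by rw [hQ, hPJv, sub_self]; rfl)
        rw [hΦ2, h5, map_zero, map_zero, Matrix.dotProduct_mulVec] at h4
        simpa using h4.symm
  let g : ℕ → (Fin m → ℝ) →L[ℝ] (σ → ℝ) := fun k =>
    LinearMap.toContinuousLinearMap ((CR ^ k).mulVecLin.comp T)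
  have hg : ∀ k y, g k y = (CR ^ k).mulVec (T y) := fun k y => rfl
  have hΩ : IsAcceptanceWindow {y | ∀ k, ‖g k y‖ ≤ 1} := by
    refine isAcceptanceWindow_of_bounded_orbits g (fun y => hbd _ (ψ.symm y).2)
      (LinearMap.toContinuousLinearMap (ψ.toLinearMap.comp Q)) fun y => ?_
    have h4 : Q (T y) = ψ.symm y := hQV _
    simp [hg, h4]
  refine ⟨Λ.projectedSet {y | ∀ k, ‖g k y‖ ≤ 1}, ⟨m, Λ, _, hgen, hΩ, rfl⟩, ?_⟩
  rintro _ ⟨_, ⟨v, hv, rfl, hv2⟩, rfl⟩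
  obtain ⟨z, rfl⟩ := (hmem _).1 hv
  have hCz : (fun i => ((C.mulVec z) i : ℝ)) = CR.mulVec fun i => (z i : ℝ) := by
    funext i; simp [CR, Matrix.mulVec, dotProduct]
  have hPC : ∀ x, P.mulVec (CR.mulVec x) = A.mulVec (P.mulVec x) := fun x => by
    rw [Matrix.mulVec_mulVec, ← hP, Matrix.mulVec_mulVec]
  refine ⟨Φ fun i => ((C.mulVec z) i : ℝ), (hmem _).2 ⟨_, rfl⟩, ?_, fun k => ?_⟩
  · rw [hΦ1, hΦ1, hCz, hPC]
  · have h4 := hv2 (k + 1)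
    rw [hg] at h4 ⊢
    convert h4 using 2
    rw [hTΦ, hTΦ, hCz, hPC, pow_succ, ← Matrix.mulVec_mulVec, Matrix.mulVec_sub CR,
      Matrix.mulVec_mulVec (M := J) (N := A), ← hJ, Matrix.mulVec_mulVec (M := CR) (N := J)]

end Construction

/-! ### Real intertwiners in general position. -/

section GenericIntertwiners

open MvPolynomial

theorem Matrix.map_re_mul_left {k l r : Type*} [Fintype l] (M : Matrix k l ℝ) (N : Matrix l r ℂ) :
    (M.map (algebraMap ℝ ℂ) * N).map Complex.re = M * N.map Complex.re := by
  ext i j; simp [Matrix.mul_apply]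

theorem Matrix.map_im_mul_left {k l r : Type*} [Fintype l] (M : Matrix k l ℝ) (N : Matrix l r ℂ) :
    (M.map (algebraMap ℝ ℂ) * N).map Complex.im = M * N.map Complex.im := by
  ext i j; simp [Matrix.mul_apply]

theorem Matrix.map_re_mul_right {k l r : Type*} [Fintype l] (N : Matrix k l ℂ) (M : Matrix l r ℝ) :
    (N * M.map (algebraMap ℝ ℂ)).map Complex.re = N.map Complex.re * M := by
  ext i j; simp [Matrix.mul_apply]

theorem Matrix.map_im_mul_right {k l r : Type*} [Fintype l] (N : Matrix k l ℂ) (M : Matrix l r ℝ) :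
    (N * M.map (algebraMap ℝ ℂ)).map Complex.im = N.map Complex.im * M := by
  ext i j; simp [Matrix.mul_apply]

/-- If each of the open conditions below is satisfied by some complex pair of intertwiners, then all
of them are satisfied by one real pair. -/
theorem exists_generic_intertwiners {n : ℕ} {σ : Type} [Fintype σ] [DecidableEq σ] [Nonempty σ]
    (A : Matrix (Fin n) (Fin n) ℝ) (C : Matrix σ σ ℝ)
    (h0 : ∃ (P : Matrix (Fin n) σ ℂ) (J : Matrix σ (Fin n) ℂ),
      A.map (algebraMap ℝ ℂ) * P = P * C.map (algebraMap ℝ ℂ) ∧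
      C.map (algebraMap ℝ ℂ) * J = J * A.map (algebraMap ℝ ℂ) ∧ P * J = 1)
    (h1 : ∀ z : σ → ℤ, z ≠ 0 → ∃ P : Matrix (Fin n) σ ℂ,
      A.map (algebraMap ℝ ℂ) * P = P * C.map (algebraMap ℝ ℂ) ∧
      P.mulVec (fun i => (z i : ℂ)) ≠ 0)
    (h2 : ∀ z : σ → ℤ, z ≠ 0 → ∃ (P : Matrix (Fin n) σ ℂ) (J : Matrix σ (Fin n) ℂ),
      A.map (algebraMap ℝ ℂ) * P = P * C.map (algebraMap ℝ ℂ) ∧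
      C.map (algebraMap ℝ ℂ) * J = J * A.map (algebraMap ℝ ℂ) ∧ P * J = 1 ∧
      J.mulVec (P.mulVec fun i => (z i : ℂ)) ≠ fun i => (z i : ℂ))
    (h3 : ∀ z : σ → ℤ, z ≠ 0 → ∃ J : Matrix σ (Fin n) ℂ,
      C.map (algebraMap ℝ ℂ) * J = J * A.map (algebraMap ℝ ℂ) ∧
      Matrix.vecMul (fun i => (z i : ℂ)) J ≠ 0) :
    ∃ (P : Matrix (Fin n) σ ℝ) (J : Matrix σ (Fin n) ℝ), A * P = P * C ∧ C * J = J * A ∧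
      P * J = 1 ∧
      (∀ z : σ → ℤ, z ≠ 0 → P.mulVec (fun i => (z i : ℝ)) ≠ 0) ∧
      (∀ z : σ → ℤ, z ≠ 0 → J.mulVec (P.mulVec fun i => (z i : ℝ)) ≠ fun i => (z i : ℝ)) ∧
      (∀ z : σ → ℤ, z ≠ 0 → Matrix.vecMul (fun i => (z i : ℝ)) J ≠ 0) := by
  classical
  let κ := (Fin n × σ) ⊕ (σ × Fin n)
  let PP : ∀ {K : Type} [CommRing K], (κ → K) → Matrix (Fin n) σ K :=
    fun w => Matrix.of fun a b => w (Sum.inl (a, b))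
  let JJ : ∀ {K : Type} [CommRing K], (κ → K) → Matrix σ (Fin n) K :=
    fun w => Matrix.of fun a b => w (Sum.inr (a, b))
  -- Only the linear intertwining equations define `T`. The normalisation `P * J = 1` is relaxed to
  -- a non-zero determinant and restored at the end by replacing `J` with `J * (P * J)⁻¹`.
  let T : Submodule ℝ (κ → ℝ) :=
    { carrier := {w | A * PP w = PP w * C ∧ C * JJ w = JJ w * A}
      add_mem' := by
        rintro a b ⟨ha, ha'⟩ ⟨hb, hb'⟩
        have e1 : PP (a + b) = PP a + PP b := rfl
        have e2 : JJ (a + b) = JJ a + JJ b := rfl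
        exact ⟨by rw [e1, Matrix.mul_add, Matrix.add_mul, ha, hb],
          by rw [e2, Matrix.mul_add, Matrix.add_mul, ha', hb']⟩
      zero_mem' := by
        have e1 : PP (0 : κ → ℝ) = 0 := rfl
        have e2 : JJ (0 : κ → ℝ) = 0 := rfl
        exact ⟨by rw [e1, Matrix.mul_zero, Matrix.zero_mul],
          by rw [e2, Matrix.mul_zero, Matrix.zero_mul]⟩
      smul_mem' := by
        rintro c a ⟨ha, ha'⟩
        have e1 : PP (c • a) = c • PP a := rfl
        have e2 : JJ (c • a) = c • JJ a := rfl
        exact ⟨by rw [e1, Matrix.mul_smul, Matrix.smul_mul, ha],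
          by rw [e2, Matrix.mul_smul, Matrix.smul_mul, ha']⟩ }
  let Z := {z : σ → ℤ // z ≠ 0}
  -- the four kinds of conditions over an arbitrary ring
  let cond : ∀ {K : Type} [CommRing K], (κ → K) → (Unit ⊕ Z) ⊕ (Z ⊕ Z) → (σ ⊕ Fin n) → K :=
    fun {K} _ w => Sum.elim
      (Sum.elim (fun _ _ => (PP w * JJ w).det)
        (fun z => Sum.elim 0 ((PP w).mulVec fun i => (z.1 i : K))))
      (Sum.elim
        -- The condition `J (P J)⁻¹ P z ≠ z`, made polynomial by multiplying through by the
        -- determinant.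
        (fun z => Sum.elim ((PP w * JJ w).det • (fun i => (z.1 i : K)) -
          (JJ w).mulVec ((PP w * JJ w).adjugate.mulVec ((PP w).mulVec fun i => (z.1 i : K)))) 0)
        (fun z => Sum.elim 0 (Matrix.vecMul (fun i => (z.1 i : K)) (JJ w))))
  have hmap : ∀ {K K' : Type} [CommRing K] [CommRing K'] (φ : K →+* K') (w : κ → K) i t,
      φ (cond w i t) = cond (φ ∘ w) i t := by
    intro K K' _ _ φ w i t
    have hP : PP (φ ∘ w) = (PP w).map φ := rfl
    have hJ : JJ (φ ∘ w) = (JJ w).map φ := rfl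
    have hz : ∀ z : σ → ℤ, (φ ∘ fun i => (z i : K)) = fun i => (z i : K') := fun z => by
      funext i; simp
    have hdet : φ (PP w * JJ w).det = (PP (φ ∘ w) * JJ (φ ∘ w)).det := by
      rw [RingHom.map_det, hP, hJ, RingHom.mapMatrix_apply, Matrix.map_mul]
    have hadj : (PP w * JJ w).adjugate.map φ = (PP (φ ∘ w) * JJ (φ ∘ w)).adjugate := by
      rw [hP, hJ, ← Matrix.map_mul]
      exact RingHom.map_adjugate φ _
    have hPz : ∀ (z : σ → ℤ), (φ ∘ (PP w).mulVec fun i => (z i : K)) =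
        (PP (φ ∘ w)).mulVec fun i => (z i : K') := fun z => by
      funext j
      rw [Function.comp_apply, RingHom.map_mulVec, hz, hP]
    rcases i with (_ | z) | (z | z) <;> rcases t with t | t
    · exact hdet
    · exact hdet
    · exact map_zero φ
    · exact congrFun (hPz z.1) t
    · change φ ((PP w * JJ w).det * (z.1 t : K) - (JJ w).mulVec _ t) = _ * (z.1 t : K') - _
      rw [map_sub, map_mul, map_intCast, hdet, RingHom.map_mulVec]
      congr 1
      have : (φ ∘ (PP w * JJ w).adjugate.mulVec ((PP w).mulVec fun i => (z.1 i : K))) =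
          (PP (φ ∘ w) * JJ (φ ∘ w)).adjugate.mulVec ((PP (φ ∘ w)).mulVec fun i => (z.1 i : K')) := by
        funext j
        rw [Function.comp_apply, RingHom.map_mulVec, hadj, hPz]
      rw [this, hJ]
    · exact map_zero φ
    · exact map_zero φ
    · change φ (Matrix.vecMul _ _ t) = _
      rw [RingHom.map_vecMul, hz]
      rfl
  have hwit : ∀ (P : Matrix (Fin n) σ ℂ) (J : Matrix σ (Fin n) ℂ),
      A.map (algebraMap ℝ ℂ) * P = P * C.map (algebraMap ℝ ℂ) →
      C.map (algebraMap ℝ ℂ) * J = J * A.map (algebraMap ℝ ℂ) → ∀ i, (∃ t,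
        cond (Sum.elim (fun q => P q.1 q.2) fun q => J q.1 q.2) i t ≠ 0) →
      ∃ w : κ → ℂ, (fun k => (w k).re) ∈ T ∧ (fun k => (w k).im) ∈ T ∧
        ∃ t, aeval w (cond (X : κ → MvPolynomial κ ℝ) i t) ≠ 0 := by
    intro P J hP hJ i ⟨t, ht⟩
    -- Real and imaginary parts of a complex solution solve the same real linear equations.
    refine ⟨Sum.elim (fun q => P q.1 q.2) fun q => J q.1 q.2, ⟨?_, ?_⟩, ⟨?_, ?_⟩, t, ?_⟩
    · exact (Matrix.map_re_mul_left A P).symm.trans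
        ((congrArg (fun M => M.map Complex.re) hP).trans (Matrix.map_re_mul_right P C))
    · exact (Matrix.map_re_mul_left C J).symm.trans
        ((congrArg (fun M => M.map Complex.re) hJ).trans (Matrix.map_re_mul_right J A))
    · exact (Matrix.map_im_mul_left A P).symm.trans
        ((congrArg (fun M => M.map Complex.im) hP).trans (Matrix.map_im_mul_right P C))
    · exact (Matrix.map_im_mul_left C J).symm.trans
        ((congrArg (fun M => M.map Complex.im) hJ).trans (Matrix.map_im_mul_right J A))
    · have := hmap (aeval (Sum.elim (fun q => P q.1 q.2) fun q => J q.1 q.2) :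
        MvPolynomial κ ℝ →ₐ[ℝ] ℂ).toRingHom X i t
      have hX : ((aeval (Sum.elim (fun q => P q.1 q.2) fun q => J q.1 q.2) :
        MvPolynomial κ ℝ →ₐ[ℝ] ℂ).toRingHom ∘ X) =
          Sum.elim (fun q => P q.1 q.2) fun q => J q.1 q.2 := by
        funext k
        exact aeval_X _ k
      rw [hX] at this
      exact fun h => ht (this.symm.trans h)
  obtain ⟨w, ⟨hwP, hwJ⟩, hw⟩ := T.exists_forall_exists_eval_ne_zero
    (fun i t => cond (X : κ → MvPolynomial κ ℝ) i t) (by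
      rintro ((_ | z) | (z | z))
      · obtain ⟨P, J, hP, hJ, hPJ⟩ := h0
        obtain ⟨s⟩ := ‹Nonempty σ›
        refine hwit P J hP hJ _ ⟨Sum.inl s, ?_⟩
        change (P * J).det ≠ 0
        rw [hPJ, Matrix.det_one]
        exact one_ne_zero
      · obtain ⟨P, hP, hPz⟩ := h1 z.1 z.2
        obtain ⟨t, ht⟩ := Function.ne_iff.1 hPz
        exact hwit P 0 hP (by rw [Matrix.mul_zero, Matrix.zero_mul]) _ ⟨Sum.inr t, ht⟩
      · obtain ⟨P, J, hP, hJ, hPJ, hz⟩ := h2 z.1 z.2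
        obtain ⟨t, ht⟩ := Function.ne_iff.1 hz
        refine hwit P J hP hJ _ ⟨Sum.inl t, ?_⟩
        change (P * J).det * (z.1 t : ℂ) -
          J.mulVec ((P * J).adjugate.mulVec (P.mulVec fun i => (z.1 i : ℂ))) t ≠ 0
        rw [hPJ, Matrix.det_one, Matrix.adjugate_one, Matrix.one_mulVec, one_mul]
        exact fun h => ht (sub_eq_zero.1 h).symm
      · obtain ⟨J, hJ, hJz⟩ := h3 z.1 z.2
        obtain ⟨t, ht⟩ := Function.ne_iff.1 hJz
        exact hwit 0 J (by rw [Matrix.mul_zero, Matrix.zero_mul]) hJ _ ⟨Sum.inr t, ht⟩)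
  replace hw : ∀ i, ∃ t, cond w i t ≠ 0 := fun i => by
    obtain ⟨t, ht⟩ := hw i
    refine ⟨t, ?_⟩
    rw [hmap] at ht
    convert ht using 2
    funext k
    simp
  set P := PP w
  set J := JJ w
  have hdet : IsUnit (P * J).det := by
    obtain ⟨t, ht⟩ := hw (Sum.inl (Sum.inl ()))
    exact isUnit_iff_ne_zero.2 ht
  have hcomm : A * (P * J)⁻¹ = (P * J)⁻¹ * A := by
    have h4 : A * (P * J) = P * J * A := by
      rw [← Matrix.mul_assoc, hwP, Matrix.mul_assoc, hwJ, Matrix.mul_assoc]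
    calc A * (P * J)⁻¹ = (P * J)⁻¹ * (P * J) * (A * (P * J)⁻¹) := by
          rw [Matrix.nonsing_inv_mul _ hdet, Matrix.one_mul]
      _ = (P * J)⁻¹ * (P * J * A) * (P * J)⁻¹ := by simp only [Matrix.mul_assoc]
      _ = (P * J)⁻¹ * A * (P * J * (P * J)⁻¹) := by rw [← h4]; simp only [Matrix.mul_assoc]
      _ = _ := by rw [Matrix.mul_nonsing_inv _ hdet, Matrix.mul_one]
  refine ⟨P, J * (P * J)⁻¹, hwP, ?_, ?_, fun z hz h => ?_, fun z hz h => ?_, fun z hz h => ?_⟩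
  · rw [← Matrix.mul_assoc, hwJ, Matrix.mul_assoc, hcomm, Matrix.mul_assoc]
  · rw [← Matrix.mul_assoc, Matrix.mul_nonsing_inv _ hdet]
  · obtain ⟨t | t, ht⟩ := hw (Sum.inl (Sum.inr ⟨z, hz⟩))
    · exact ht rfl
    · exact ht (congrFun h t)
  · obtain ⟨t | t, ht⟩ := hw (Sum.inr (Sum.inl ⟨z, hz⟩))
    · apply ht
      change (P * J).det * (z t : ℝ) -
          J.mulVec ((P * J).adjugate.mulVec (P.mulVec fun i => (z i : ℝ))) t = 0
      have hadj : (P * J).adjugate = (P * J).det • (P * J)⁻¹ := by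
        rw [Matrix.inv_def, smul_smul, Ring.mul_inverse_cancel _ hdet, one_smul]
      have h4 := congrFun h t
      rw [← Matrix.mulVec_mulVec] at h4
      rw [hadj, Matrix.smul_mulVec, Matrix.mulVec_smul, Pi.smul_apply, smul_eq_mul, h4, sub_self]
    · exact ht rfl
  · obtain ⟨t | t, ht⟩ := hw (Sum.inr (Sum.inr ⟨z, hz⟩))
    · exact ht rfl
    · apply ht
      change Matrix.vecMul (fun i => (z i : ℝ)) J t = 0
      rw [← Matrix.vecMul_vecMul] at h
      have h4 := congrArg (fun v => Matrix.vecMul v (P * J)) h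
      simp only [Matrix.vecMul_vecMul, Matrix.zero_vecMul] at h4
      rw [Matrix.mul_assoc, Matrix.nonsing_inv_mul _ hdet, Matrix.mul_one] at h4
      exact congrFun h4 t

end GenericIntertwiners

/-! ### Boundedness on the kernel of `P`. -/

section BoundedOrbits

/-- If every eigenvalue of `C` of modulus greater than one is an eigenvalue of `A` with the same
multiplicity, then the orbits of `C` on the kernel of a split surjective intertwiner are bounded. -/
theorem Matrix.bounded_orbits_of_mulVec_eq_zero {n : ℕ} {σ : Type*} [Fintype σ] [DecidableEq σ]
    {A : Matrix (Fin n) (Fin n) ℝ} {C : Matrix σ σ ℝ} {S S' : Matrix (Fin n) (Fin n) ℂ}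
    {d : Fin n → ℂ} (hSS : S' * S = 1)
    (hSA : A.map (algebraMap ℝ ℂ) * S = S * Matrix.diagonal d)
    {R U : Matrix σ σ ℂ} {D : σ → ℂ} (hRU : R * U = 1)
    (hRC : R * C.map (algebraMap ℝ ℂ) = Matrix.diagonal D * R)
    {e : Fin n → σ} (he : Function.Injective e) (hDe : ∀ j, D (e j) = d j)
    (hD : ∀ a, a ∉ Set.range e → ‖D a‖ ≤ 1)
    {P : Matrix (Fin n) σ ℝ} {J : Matrix σ (Fin n) ℝ} (hP : A * P = P * C) (hJ : C * J = J * A)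
    (hPJ : P * J = 1) (x : σ → ℝ) (hx : P.mulVec x = 0) :
    ∃ K, ∀ k : ℕ, ‖(C ^ k).mulVec x‖ ≤ K := by
  classical
  set Ac := A.map (algebraMap ℝ ℂ)
  set Cc := C.map (algebraMap ℝ ℂ)
  set Pc := P.map (algebraMap ℝ ℂ)
  set Jc := J.map (algebraMap ℝ ℂ)
  have hUR : U * R = 1 := mul_eq_one_comm.1 hRU
  have hSS' : S * S' = 1 := mul_eq_one_comm.1 hSS
  have hPc : Ac * Pc = Pc * Cc := by
    rw [← Matrix.map_mul, hP, Matrix.map_mul]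
  have hJc : Cc * Jc = Jc * Ac := by
    rw [← Matrix.map_mul, hJ, Matrix.map_mul]
  have hPJc : Pc * Jc = 1 := by
    rw [← Matrix.map_mul, hPJ, Matrix.map_one _ (map_zero _) (map_one _)]
  have hCU : Cc * U = U * Matrix.diagonal D := by
    calc Cc * U = U * (R * Cc) * U := by rw [← Matrix.mul_assoc, hUR, Matrix.one_mul]
      _ = U * Matrix.diagonal D * (R * U) := by rw [hRC]; simp only [Matrix.mul_assoc]
      _ = _ := by rw [hRU, Matrix.mul_one]
  have hSA' : S' * Ac = Matrix.diagonal d * S' := by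
    calc S' * Ac = S' * (Ac * S) * S' := by
          rw [Matrix.mul_assoc, Matrix.mul_assoc, hSS', Matrix.mul_one]
      _ = S' * S * Matrix.diagonal d * S' := by rw [hSA]; simp only [Matrix.mul_assoc]
      _ = _ := by rw [hSS, Matrix.one_mul]
  -- `P` in the eigenbases: the entry `Y j a` vanishes unless `D a = d j`.
  let Y := S' * Pc * U
  let Y' := R * Jc * S
  have hY : Y * Matrix.diagonal D = Matrix.diagonal d * Y := by
    simp only [Y]
    rw [Matrix.mul_assoc, ← hCU, ← Matrix.mul_assoc, Matrix.mul_assoc S' Pc Cc, ← hPc,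
      ← Matrix.mul_assoc S', hSA']
    simp only [Matrix.mul_assoc]
  have hYY : Y * Y' = 1 := by
    calc Y * Y' = S' * Pc * (U * R) * (Jc * S) := by simp only [Y, Y', Matrix.mul_assoc]
      _ = S' * (Pc * Jc) * S := by rw [hUR, Matrix.mul_one]; simp only [Matrix.mul_assoc]
      _ = 1 := by rw [hPJc, Matrix.mul_one, hSS]
  have hY0 : ∀ j a, Y j a ≠ 0 → D a = d j := by
    intro j a h
    have := congrFun (congrFun hY j) a
    rw [Matrix.mul_diagonal, Matrix.diagonal_mul, mul_comm] at this
    exact mul_right_cancel₀ h this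
  let I := {j : Fin n // 1 < ‖d j‖}
  let f : I → σ := fun j => e j.1
  have hf : Function.Injective f := he.comp Subtype.val_injective
  have hYf : ∀ (j : I) a, a ∉ Set.range f → Y j.1 a = 0 := by
    intro j a ha
    by_contra h
    have h1 := hY0 _ _ h
    by_cases h2 : a ∈ Set.range e
    · obtain ⟨j', rfl⟩ := h2
      exact ha ⟨⟨j', by rw [← hDe, h1]; exact j.2⟩, rfl⟩
    · exact absurd (hD a h2) (not_le.2 (h1 ▸ j.2))
  -- The rows of `Y` for eigenvalues outside the disc are supported on this square block. It is
  -- invertible, so `Y y = 0` forces the expanding coordinates of `y` to vanish.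
  let M : Matrix I I ℂ := Matrix.of fun j j' => Y j.1 (f j')
  let M' : Matrix I I ℂ := Matrix.of fun j j' => Y' (f j) j'.1
  have hMM : M * M' = 1 := by
    ext j j'
    have h1 := congrFun (congrFun hYY j.1) j'.1
    rw [Matrix.mul_apply] at h1 ⊢
    refine (Fintype.sum_of_injective f hf _ (fun a => Y j.1 a * Y' a j'.1)
      (fun a ha => by rw [hYf j a ha, zero_mul]) (fun i => rfl)).trans (h1.trans ?_)
    rw [Matrix.one_apply, Matrix.one_apply]
    exact if_congr Subtype.ext_iff.symm rfl rfl
  have hMM' : M' * M = 1 := mul_eq_one_comm.1 hMM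
  let xc : σ → ℂ := fun i => (x i : ℂ)
  let y := R.mulVec xc
  have hPx : Pc.mulVec xc = 0 := by
    funext j
    have := congrArg (algebraMap ℝ ℂ) (congrFun hx j)
    rw [RingHom.map_mulVec] at this
    exact this.trans (map_zero _)
  have hYy : Y.mulVec y = 0 := by
    simp only [Y, y]
    rw [Matrix.mulVec_mulVec, Matrix.mul_assoc, hUR, Matrix.mul_one, ← Matrix.mulVec_mulVec, hPx,
      Matrix.mulVec_zero]
  have hy : ∀ a, y a = 0 ∨ ‖D a‖ ≤ 1 := by
    intro a
    by_cases h2 : a ∈ Set.range e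
    · obtain ⟨j, rfl⟩ := h2
      rw [or_iff_not_imp_right, not_le, hDe]
      intro hj
      have h3 : M.mulVec (y ∘ f) = 0 := by
        funext i
        have h4 := congrFun hYy i.1
        rw [Matrix.mulVec, dotProduct] at h4 ⊢
        exact (Fintype.sum_of_injective f hf _ (fun a => Y i.1 a * y a)
          (fun a ha => by rw [hYf i a ha, zero_mul]) (fun i => rfl)).trans h4
      have h5 := congrArg M'.mulVec h3
      rw [Matrix.mulVec_mulVec, hMM', Matrix.one_mulVec, Matrix.mulVec_zero] at h5
      exact congrFun h5 ⟨j, hj⟩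
    · exact Or.inr (hD a h2)
  have hRCk : ∀ k : ℕ, R * Cc ^ k = Matrix.diagonal D ^ k * R := by
    intro k
    induction k with
    | zero => simp
    | succ k ih => rw [pow_succ, ← Matrix.mul_assoc, ih, Matrix.mul_assoc, hRC, ← Matrix.mul_assoc,
        pow_succ]
  refine ⟨∑ b, ∑ a, ‖U b a‖ * ‖y a‖, fun k => ?_⟩
  have hnn : ∀ b, 0 ≤ ∑ a, ‖U b a‖ * ‖y a‖ := fun b => Finset.sum_nonneg fun a _ => by positivity
  rw [pi_norm_le_iff_of_nonneg (Finset.sum_nonneg fun b _ => hnn b)]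
  intro b
  have h1 : (((C ^ k).mulVec x b : ℝ) : ℂ) = U.mulVec ((Matrix.diagonal D ^ k).mulVec y) b := by
    have h2 : Cc ^ k = (C ^ k).map (algebraMap ℝ ℂ) :=
      (map_pow (algebraMap ℝ ℂ).mapMatrix C k).symm
    have h3 : (((C ^ k).mulVec x b : ℝ) : ℂ) = (Cc ^ k).mulVec xc b := by
      rw [h2]
      exact RingHom.map_mulVec (algebraMap ℝ ℂ) (C ^ k) x b
    rw [h3, Matrix.mulVec_mulVec (M := Matrix.diagonal D ^ k), ← hRCk, Matrix.mulVec_mulVec,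
      ← Matrix.mul_assoc, hUR, Matrix.one_mul]
  calc ‖(C ^ k).mulVec x b‖ = ‖U.mulVec ((Matrix.diagonal D ^ k).mulVec y) b‖ := by
        rw [← h1, Complex.norm_real]
    _ ≤ ∑ a, ‖U b a‖ * ‖y a‖ := by
        rw [Matrix.mulVec, dotProduct]
        refine (norm_sum_le _ _).trans (Finset.sum_le_sum fun a _ => ?_)
        rw [norm_mul, Matrix.diagonal_pow, Matrix.mulVec_diagonal, norm_mul, Pi.pow_apply, norm_pow]
        refine mul_le_mul_of_nonneg_left ?_ (norm_nonneg _)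
        rcases hy a with h | h
        · simp [h]
        · exact mul_le_of_le_one_left (norm_nonneg _) (pow_le_one₀ (norm_nonneg _) h)
    _ ≤ _ := Finset.single_le_sum (f := fun b => ∑ a, ‖U b a‖ * ‖y a‖) (fun b _ => hnn b)
        (Finset.mem_univ b)

end BoundedOrbits

/-! ### Complex witnesses and the sufficient direction. -/

section Sufficiency

open Polynomial

theorem Matrix.charpoly_eq_of_mul_eq_mul_diagonal {ι K : Type*} [Fintype ι] [DecidableEq ι]
    [Field K] {B S S' : Matrix ι ι K} {d : ι → K} (hSS : S' * S = 1)
    (h : B * S = S * Matrix.diagonal d) : B.charpoly = ∏ i, (X - C (d i)) := by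
  have hSS' : S * S' = 1 := mul_eq_one_comm.1 hSS
  have hB : B = S * Matrix.diagonal d * S' := by
    rw [← h, Matrix.mul_assoc, hSS', Matrix.mul_one]
  rw [hB, Matrix.mul_assoc, Matrix.charpoly_mul_comm, Matrix.mul_assoc, hSS, Matrix.mul_one,
    Matrix.charpoly_diagonal]

theorem Polynomial.rootMultiplicity_prod_X_sub_C {ι K : Type*} [Fintype ι] [Field K]
    (d : ι → K) (z : K) :
    (∏ i, (X - C (d i))).rootMultiplicity z = Nat.card {i // d i = z} := by
  classical
  rw [← count_roots, Polynomial.roots_prod _ _ (Finset.prod_ne_zero_iff.2 fun i _ =>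
    X_sub_C_ne_zero _)]
  simp only [roots_X_sub_C, Multiset.bind_singleton]
  rw [Multiset.count_map, Nat.card_eq_fintype_card, Fintype.card_subtype]
  simp only [eq_comm (a := z)]
  rfl

/-- It remains to meet each genericity condition separately over `ℂ`. A column eigenvector times a
row eigenvector for the same eigenvalue is an intertwiner, and the integral model supplies such
pairs that do not annihilate `z`. -/
theorem exists_isCutAndProjectSet_of_eigenvalues {n : ℕ} (hn : 1 ≤ n)
    {A : Matrix (Fin n) (Fin n) ℝ} {S S' : Matrix (Fin n) (Fin n) ℂ}
    {d : Fin n → ℂ} (hSS : S' * S = 1)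
    (hSA : A.map (algebraMap ℝ ℂ) * S = S * Matrix.diagonal d)
    (hint : ∀ j, IsIntegral ℤ (d j))
    (hd : ∀ μ : ℂ, 1 < ‖μ‖ → (∃ j, IsConjRoot ℚ μ (d j)) →
      (∀ ν : ℂ, IsConjRoot ℚ ν μ → Nat.card {j // d j = ν} ≤ Nat.card {j // d j = μ}) ∧
      ∃ ν : ℂ, IsConjRoot ℚ ν μ ∧ Nat.card {j // d j = ν} < Nat.card {j // d j = μ}) :
    ∃ S : Set (Fin n → ℝ), IsCutAndProjectSet S ∧ A.mulVec '' S ⊆ S := by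
  obtain ⟨σ, _, _, C, R, U, D, e, hRU, hRC, he, hDe, hD, hz1, hz2, hz3⟩ :=
    exists_integral_model d hint hd
  have : Nonempty σ := ⟨e ⟨0, hn⟩⟩
  set CR := C.map (algebraMap ℤ ℝ)
  have hCC : CR.map (algebraMap ℝ ℂ) = C.map (algebraMap ℤ ℂ) := by
    ext i j; simp [CR]
  set Cc := C.map (algebraMap ℤ ℂ)
  set Ac := A.map (algebraMap ℝ ℂ)
  have hUR : U * R = 1 := mul_eq_one_comm.1 hRU
  have hSS' : S * S' = 1 := mul_eq_one_comm.1 hSS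
  have hCU : Cc * U = U * Matrix.diagonal D := by
    calc Cc * U = U * (R * Cc) * U := by rw [← Matrix.mul_assoc, hUR, Matrix.one_mul]
      _ = U * Matrix.diagonal D * (R * U) := by rw [hRC]; simp only [Matrix.mul_assoc]
      _ = _ := by rw [hRU, Matrix.mul_one]
  have hSA' : S' * Ac = Matrix.diagonal d * S' := by
    calc S' * Ac = S' * (Ac * S) * S' := by
          rw [Matrix.mul_assoc, Matrix.mul_assoc, hSS', Matrix.mul_one]
      _ = S' * S * Matrix.diagonal d * S' := by rw [hSA]; simp only [Matrix.mul_assoc]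
      _ = _ := by rw [hSS, Matrix.one_mul]
  -- eigenvectors
  have hRrow : ∀ a, Matrix.vecMul (R a) Cc = D a • R a := fun a => by
    rw [← Matrix.mul_apply_eq_vecMul, hRC]
    ext i; simp [Matrix.diagonal_mul]
  have hUcol : ∀ a, Cc.mulVec (fun i => U i a) = D a • fun i => U i a := fun a => by
    funext i
    have := congrFun (congrFun hCU i) a
    rw [Matrix.mul_diagonal, Matrix.mul_apply] at this
    rw [Pi.smul_apply, smul_eq_mul, mul_comm, ← this]
    rfl
  have hSrow : ∀ j, Matrix.vecMul (S' j) Ac = d j • S' j := fun j => by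
    rw [← Matrix.mul_apply_eq_vecMul, hSA']
    ext i; simp [Matrix.diagonal_mul]
  have hScol : ∀ j, Ac.mulVec (fun i => S i j) = d j • fun i => S i j := fun j => by
    funext i
    have := congrFun (congrFun hSA i) j
    rw [Matrix.mul_diagonal, Matrix.mul_apply] at this
    rw [Pi.smul_apply, smul_eq_mul, mul_comm, ← this]
    rfl
  have hU0 : ∀ a, (fun i => U i a) ≠ 0 := fun a h => by
    have h1 := congrFun (congrFun hRU a) a
    have h2 : ∀ i, U i a = 0 := congrFun h
    simp [Matrix.mul_apply, h2] at h1
  have hS0 : ∀ j, (fun i => S i j) ≠ 0 := fun j h => by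
    have h1 := congrFun (congrFun hSS j) j
    have h2 : ∀ i, S i j = 0 := congrFun h
    simp [Matrix.mul_apply, h2] at h1
  have hS0' : ∀ j, S' j ≠ 0 := fun j h => by
    have h1 := congrFun (congrFun hSS j) j
    simp [Matrix.mul_apply, h] at h1
  -- the standard pair of intertwiners
  let P₀ : Matrix (Fin n) σ ℂ := S * R.submatrix e id
  let J₀ : Matrix σ (Fin n) ℂ := U.submatrix id e * S'
  have hP₀ : Ac * P₀ = P₀ * Cc := by
    have h1 : R.submatrix e id * Cc = Matrix.diagonal d * R.submatrix e id := by
      ext j i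
      have := congrFun (congrFun hRC (e j)) i
      rw [Matrix.diagonal_mul, hDe] at this
      rw [Matrix.diagonal_mul]
      exact this
    simp only [P₀]
    rw [← Matrix.mul_assoc, hSA, Matrix.mul_assoc, ← h1, Matrix.mul_assoc]
  have hJ₀ : Cc * J₀ = J₀ * Ac := by
    have h1 : Cc * U.submatrix id e = U.submatrix id e * Matrix.diagonal d := by
      ext i j
      have := congrFun (congrFun hCU i) (e j)
      rw [Matrix.mul_diagonal, hDe] at this
      rw [Matrix.mul_diagonal]
      exact this
    simp only [J₀]
    rw [← Matrix.mul_assoc, h1, Matrix.mul_assoc, ← hSA', Matrix.mul_assoc]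
  have hPJ₀ : P₀ * J₀ = 1 := by
    have h1 : R.submatrix e id * U.submatrix id e = 1 := by
      rw [← Matrix.submatrix_mul _ _ _ _ _ Function.bijective_id, hRU, Matrix.submatrix_one _ he]
    calc P₀ * J₀ = S * (R.submatrix e id * U.submatrix id e) * S' := by
          simp only [P₀, J₀, Matrix.mul_assoc]
      _ = 1 := by rw [h1, Matrix.mul_one, hSS']
  clear_value J₀
  obtain ⟨P, J, hP, hJ, hPJ, h1, h2, h3⟩ := exists_generic_intertwiners A CR
    (by rw [hCC]; exact ⟨P₀, J₀, hP₀, hJ₀, hPJ₀⟩)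
    (fun z hz => by
      rw [hCC]
      obtain ⟨j, a, hja, ha⟩ := hz1 z hz
      refine ⟨Matrix.vecMulVec (fun i => S i j) (R a), ?_, ?_⟩
      · rw [Matrix.mul_vecMulVec, Matrix.vecMulVec_mul, hScol, hRrow, hja,
          Matrix.smul_vecMulVec, Matrix.vecMulVec_smul]
      · intro h
        obtain ⟨i, hi⟩ := Function.ne_iff.1 (hS0 j)
        have := congrFun h i
        rw [Matrix.vecMulVec_mulVec] at this
        simp only [Pi.smul_apply, MulOpposite.smul_eq_mul_unop, MulOpposite.unop_op] at this
        exact mul_ne_zero hi ha this)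
    (fun z hz => by
      rw [hCC]
      by_cases hJz : J₀.mulVec (P₀.mulVec fun i => (z i : ℂ)) = fun i => (z i : ℂ)
      -- If the standard pair fixes `z`, add to `J₀` the rank-one intertwiner with column `U b` and
      -- row `R a * J₀`. Since `b` is outside the range of `e`, `P₀` kills `U b` and `P J = 1`
      -- persists, while the image of `z` moves by the non-zero multiple `(R z) a` of `U b`.
      · obtain ⟨a, b, hab, ha, hb⟩ := hz3 z hz
        have hPb : P₀.mulVec (fun i => U i b) = 0 := by
          simp only [P₀]
          rw [← Matrix.mulVec_mulVec]
          have : (R.submatrix e id).mulVec (fun i => U i b) = 0 := by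
            funext j
            have h4 := congrFun (congrFun hRU (e j)) b
            rw [Matrix.one_apply_ne (fun h => hb ⟨j, h⟩)] at h4
            exact h4
          rw [this, Matrix.mulVec_zero]
        refine ⟨P₀, J₀ + Matrix.vecMulVec (fun i => U i b) (Matrix.vecMul (R a) J₀), hP₀, ?_, ?_,
          fun h => ?_⟩
        · rw [Matrix.mul_add, Matrix.add_mul, hJ₀, Matrix.mul_vecMulVec, Matrix.vecMulVec_mul,
            hUcol, Matrix.vecMul_vecMul, ← hJ₀, ← Matrix.vecMul_vecMul, hRrow, hab,
            Matrix.smul_vecMul, Matrix.smul_vecMulVec, Matrix.vecMulVec_smul]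
        · rw [Matrix.mul_add, hPJ₀, Matrix.mul_vecMulVec, hPb, Matrix.zero_vecMulVec, add_zero]
        · rw [Matrix.add_mulVec, hJz, add_eq_left, Matrix.vecMulVec_mulVec,
            ← Matrix.dotProduct_mulVec, hJz] at h
          obtain ⟨i, hi⟩ := Function.ne_iff.1 (hU0 b)
          have h4 := congrFun h i
          simp only [Pi.smul_apply, MulOpposite.smul_eq_mul_unop, MulOpposite.unop_op] at h4
          exact mul_ne_zero hi ha h4
      · exact ⟨P₀, J₀, hP₀, hJ₀, hPJ₀, hJz⟩)
    (fun z hz => by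
      rw [hCC]
      obtain ⟨j, a, hja, ha⟩ := hz2 z hz
      refine ⟨Matrix.vecMulVec (fun i => U i a) (S' j), ?_, ?_⟩
      · rw [Matrix.mul_vecMulVec, Matrix.vecMulVec_mul, hUcol, hSrow, hja,
          Matrix.smul_vecMulVec, Matrix.vecMulVec_smul]
      · intro h
        obtain ⟨i, hi⟩ := Function.ne_iff.1 (hS0' j)
        have := congrFun h i
        rw [Matrix.vecMul_vecMulVec] at this
        exact mul_ne_zero ha hi this)
  have hσ : n < Fintype.card σ := by
    -- Any non-zero integral vector yields a label outside the range of `e`, so the internal space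
    -- is non-trivial.
    obtain ⟨-, b, -, -, hb⟩ := hz3 1 one_ne_zero
    simpa using Fintype.card_lt_of_injective_of_notMem e he hb
  exact exists_isCutAndProjectSet_of_intertwiners hn A C P J hPJ hP hJ h1 h2 h3 hσ
    fun x hx => Matrix.bounded_orbits_of_mulVec_eq_zero hSS hSA hRU (hCC ▸ hRC) he hDe hD hP hJ hPJ
      x hx

end Sufficiency

theorem mainTheorem3 (n : ℕ) (hn : 1 ≤ n) (A : Matrix (Fin n) (Fin n) ℝ)
    (hA : IsUnit A.det) (hdiag : A.DiagonalizableOverComplex) :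
    (∃ S : Set (Fin n → ℝ), IsCutAndProjectSet S ∧ A.mulVec '' S ⊆ S) ↔
      ((∀ z ∈ spectrum ℂ A.complexified, IsIntegral ℤ z) ∧
        ∀ μ : ℂ, 1 < ‖μ‖ → (∃ z ∈ spectrum ℂ A.complexified, IsConjRoot ℚ μ z) →
          μ ∈ spectrum ℂ A.complexified ∧
          (∀ ν : ℂ, IsConjRoot ℚ ν μ → A.eigenMultiplicity ν ≤ A.eigenMultiplicity μ) ∧
          ∃ ν : ℂ, IsConjRoot ℚ ν μ ∧ A.eigenMultiplicity ν < A.eigenMultiplicity μ) := by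
  constructor
  · rintro ⟨_, ⟨m, Λ, Ω, hΛ, hΩ, rfl⟩, hS⟩
    exact Λ.spectrum_of_mulVec_image_subset hΛ hΩ A hS
  · rintro ⟨hint, hμ⟩
    obtain ⟨S, d, hS, hSA⟩ := hdiag
    have hSS : S⁻¹ * S = 1 := Matrix.nonsing_inv_mul _ hS
    have hmult : ∀ z, A.eigenMultiplicity z = Nat.card {j // d j = z} := fun z => by
      rw [Matrix.eigenMultiplicity, Matrix.charpoly_eq_of_mul_eq_mul_diagonal hSS hSA,
        Polynomial.rootMultiplicity_prod_X_sub_C]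
    have hspec : ∀ j, d j ∈ spectrum ℂ A.complexified := fun j => by
      rw [Matrix.mem_spectrum_complexified_iff, hmult]
      exact Nat.card_pos_iff.2 ⟨⟨⟨j, rfl⟩⟩, inferInstance⟩
    refine exists_isCutAndProjectSet_of_eigenvalues hn hSS hSA (fun j => hint _ (hspec j))
      fun μ h1 ⟨j, hj⟩ => ?_
    obtain ⟨-, h2, h3⟩ := hμ μ h1 ⟨d j, hspec j, hj⟩
    simp only [hmult] at h2 h3
    exact ⟨h2, h3⟩
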